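/- A database $D\in\{\pm1\}^{n\times d}$ has rows $D_1,\dots,D_n$; its one-way marginals are $\overline D=\frac1n\sum_{i=1}^n D_i\in[-1,1]^d$. A randomized mechanism $M:\{\pm1\}^{n\times d}\to[-1,1]^d$ is $(\varepsilon,\delta)$-differentially private if $\Pr[M(D)\in S]\le e^{\varepsilon}\Pr[M(D')\in S]+\delta$ for all measurable $S\subseteq[-1,1]^d$ and all $D,D'$ that differ only in a single row. There are a randomized algorithm $P$, a polynomial $p$ and a function $w:\mathbb N\to\mathbb R$ with $w(d)\to\infty$ as $d\to\infty$ (so $d^{-w(d)}=d^{-\omega(1)}$) such that the following holds. For all constants $\varepsilon_0$ and $\delta_0<1$ there is a constant $C>0$ such that for all $0<\varepsilon\le\varepsilon_0$, $0<\delta\le\delta_0$, $\alpha>0$ and all integers $d\ge1$, $n\ge1$ with $$n\;\ge\; C\cdot\frac{\sqrt{d\cdot\log(1/\delta)\cdot\log\log d}}{\varepsilon\,\alpha}$$ (the square root is read as $0$ when $d\le2$), the algorithm $P$, given $n,d,\varepsilon,\delta,\alpha$, implements a mechanism $M:\{\pm1\}^{n\times d}\to[-1,1]^d$ that is $(\varepsilon,\delta)$-differentially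 private and satisfies $$\forall D\in\{\pm1\}^{n\times d}\qquad \Pr_M\bigl[\|M(D)-\overline D\|_\infty\ge\alpha\bigr]\le\frac1{d^{\,w(d)}},$$ and $P$ always performs at most $p(n,d)$ steps. Here algorithms compute with exact real numbers and natural-number registers; arithmetic operations, square roots, logarithms, comparisons, memory accesses, loop iterations, and independent draws from the uniform distribution on $[0,1]$ and from $N(0,1)$ cost one step each. -/

import Mathlib

open MeasureTheory ProbabilityTheory Filter

noncomputable section

namespace OneWayMarginals

/-! ### Databases, marginals, differential privacy -/

/-- Databases in `{±1}^{n × d}`; the `n` rows are the individuals. -/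
abbrev Database (n d : ℕ) : Type := Matrix (Fin n) (Fin d) ℤˣ

/-- The vector of one-way marginals `(1/n) ∑ᵢ Dᵢ`. -/
def marginals {n d : ℕ} (D : Database n d) : Fin d → ℝ :=
  fun j => (1 / (n : ℝ)) * ∑ i, (((D i j : ℤˣ) : ℤ) : ℝ)

/-- Two databases are adjacent if they differ only in a single row. -/
def Adjacent {n d : ℕ} (D D' : Database n d) : Prop :=
  ∃ i, ∀ i', i' ≠ i → D i' = D' i'

/-- The cube `[-1, 1]^d`. -/
abbrev Cube (d : ℕ) : Type := Fin d → Set.Icc (-1 : ℝ) 1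

/-- The inclusion of the cube in `ℝ^d` (with the sup norm). -/
def Cube.toReal {d : ℕ} (y : Cube d) : Fin d → ℝ := fun j => (y j : ℝ)

/-- A randomized mechanism `{±1}^{n × d} → [±1]^d`, given by its output distributions. -/
abbrev Mechanism (n d : ℕ) : Type := Database n d → ProbabilityMeasure (Cube d)

/-- `(ε, δ)`-differential privacy. -/
def IsDP {n d : ℕ} (ε δ : ℝ) (M : Mechanism n d) : Prop :=
  ∀ D D' : Database n d, Adjacent D D' → ∀ S : Set (Cube d), MeasurableSet S →
    (M D : Measure (Cube d)).real S ≤ Real.exp ε * (M D' : Measure (Cube d)).real S + δ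

/-! ### Randomized algorithms over the reals, with a step count

A program works on natural-number registers and on arrays of real numbers. Every arithmetic
operation, memory access, comparison, random draw and loop iteration costs one step. There is no
operation that turns a real number into a natural number, and the only constants are
natural numbers. -/

/-- Natural-number expressions; `sub` is truncated subtraction. -/
inductive NExpr : Type
  | const (k : ℕ)
  | reg (r : ℕ)
  | add (e f : NExpr)
  | sub (e f : NExpr)

/-- Real expressions. `read a i` is cell `i` of array `a`, `data i j` is the entry `D_{ij}` of the
input database, `unif i` is the `i`-th of a sequence of independent uniform samples from
`[0, 1]`, and `normal i` is the `i`-th of a sequence of independent standard normal samples. -/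
inductive RExpr : Type
  | ofNat (e : NExpr)
  | read (a : ℕ) (i : NExpr)
  | data (i j : NExpr)
  | unif (i : NExpr)
  | normal (i : NExpr)
  | add (x y : RExpr)
  | sub (x y : RExpr)
  | mul (x y : RExpr)
  | div (x y : RExpr)
  | sqrt (x : RExpr)
  | log (x : RExpr)

/-- Programs: assignments to a register or to an array cell, composition, branching on a
comparison `x ≤ y` of reals, and `loop r e s`, which evaluates `e` once, to `N` say, and then runs
`s` with register `r` set to `0, …, N - 1` in turn. -/
inductive Program : Type
  | skip
  | setNat (r : ℕ) (e : NExpr)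
  | setReal (a : ℕ) (i : NExpr) (x : RExpr)
  | seq (s t : Program)
  | ifLE (x y : RExpr) (s t : Program)
  | loop (r : ℕ) (e : NExpr) (s : Program)

/-- The working memory: registers and arrays. -/
structure State : Type where
  nat : ℕ → ℕ
  real : ℕ → ℕ → ℝ

/-- The results of the random draws: uniform samples and standard normal samples. -/
abbrev Randomness : Type := (ℕ → unitInterval) × (ℕ → ℝ)

/-- The law of the random draws: all of them are independent. -/
def randomnessLaw : Measure Randomness :=
  (Measure.infinitePi fun _ : ℕ => (volume : Measure unitInterval)).prod
    (Measure.infinitePi fun _ : ℕ => gaussianReal 0 1)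

/-- What a program can read but not change. -/
structure Env : Type where
  data : ℕ → ℕ → ℝ
  rand : Randomness

def State.setNat (σ : State) (r k : ℕ) : State :=
  { σ with nat := Function.update σ.nat r k }

def State.setReal (σ : State) (a i : ℕ) (x : ℝ) : State :=
  { σ with real := Function.update σ.real a (Function.update (σ.real a) i x) }

def NExpr.eval (σ : State) : NExpr → ℕ
  | .const k => k
  | .reg r => σ.nat r
  | .add e f => e.eval σ + f.eval σ
  | .sub e f => e.eval σ - f.eval σ

def NExpr.cost : NExpr → ℕ
  | .const _ => 1
  | .reg _ => 1
  | .add e f => e.cost + f.cost + 1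
  | .sub e f => e.cost + f.cost + 1

def RExpr.eval (E : Env) (σ : State) : RExpr → ℝ
  | .ofNat e => (e.eval σ : ℝ)
  | .read a i => σ.real a (i.eval σ)
  | .data i j => E.data (i.eval σ) (j.eval σ)
  | .unif i => (E.rand.1 (i.eval σ) : ℝ)
  | .normal i => E.rand.2 (i.eval σ)
  | .add x y => x.eval E σ + y.eval E σ
  | .sub x y => x.eval E σ - y.eval E σ
  | .mul x y => x.eval E σ * y.eval E σ
  | .div x y => x.eval E σ / y.eval E σ
  | .sqrt x => Real.sqrt (x.eval E σ)
  | .log x => Real.log (x.eval E σ)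

def RExpr.cost : RExpr → ℕ
  | .ofNat e => e.cost + 1
  | .read _ i => i.cost + 1
  | .data i j => i.cost + j.cost + 1
  | .unif i => i.cost + 1
  | .normal i => i.cost + 1
  | .add x y => x.cost + y.cost + 1
  | .sub x y => x.cost + y.cost + 1
  | .mul x y => x.cost + y.cost + 1
  | .div x y => x.cost + y.cost + 1
  | .sqrt x => x.cost + 1
  | .log x => x.cost + 1

/-- `iter f N σ` applies `f 0`, `f 1`, …, `f (N - 1)` to `σ`, in this order. -/
def iter (f : ℕ → State → State) : ℕ → State → State
  | 0, σ => σ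
  | N + 1, σ => f N (iter f N σ)

open Classical in
/-- The memory after running a program. -/
def Program.exec (E : Env) : Program → State → State
  | .skip, σ => σ
  | .setNat r e, σ => σ.setNat r (e.eval σ)
  | .setReal a i x, σ => σ.setReal a (i.eval σ) (x.eval E σ)
  | .seq s t, σ => t.exec E (s.exec E σ)
  | .ifLE x y s t, σ => if x.eval E σ ≤ y.eval E σ then s.exec E σ else t.exec E σ
  | .loop r e s, σ => iter (fun k τ => s.exec E (τ.setNat r k)) (e.eval σ) σ

open Classical in
/-- The number of steps that a program performs. -/
def Program.steps (E : Env) : Program → State → ℕ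
  | .skip, _ => 1
  | .setNat _ e, _ => e.cost + 1
  | .setReal _ i x, _ => i.cost + x.cost + 1
  | .seq s t, σ => s.steps E σ + t.steps E (s.exec E σ)
  | .ifLE x y s t, σ =>
      x.cost + y.cost + 1 + if x.eval E σ ≤ y.eval E σ then s.steps E σ else t.steps E σ
  | .loop r e s, σ =>
      e.cost + 1 + ∑ k ∈ Finset.range (e.eval σ),
        (1 + s.steps E ((iter (fun l τ => s.exec E (τ.setNat r l)) k σ).setNat r k))

/-- The input database (entries outside the `n × d` range read as `0`) and the random draws. -/
def inputEnv {n d : ℕ} (D : Database n d) (ω : Randomness) : Env where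
  data i j := if h : i < n ∧ j < d then (((D ⟨i, h.1⟩ ⟨j, h.2⟩ : ℤˣ) : ℤ) : ℝ) else 0
  rand := ω

/-- The initial memory: registers `0`, `1` hold `n`, `d`; cells `0`, `1`, `2` of array `0` hold
`ε`, `δ`, `α`; everything else is `0`. -/
def initState (n d : ℕ) (ε δ α : ℝ) : State where
  nat r := if r = 0 then n else if r = 1 then d else 0
  real a i :=
    if a = 0 then (if i = 0 then ε else if i = 1 then δ else if i = 2 then α else 0) else 0

/-- The output of a program: the cells `0, …, d - 1` of array `1` at the end. -/
def Program.output (P : Program) {n d : ℕ} (ε δ α : ℝ) (D : Database n d) (ω : Randomness) :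
    Fin d → ℝ :=
  fun j => (P.exec (inputEnv D ω) (initState n d ε δ α)).real 1 j

/-- The number of steps on the given input, with the given results of the random draws. -/
def Program.runtime (P : Program) {n d : ℕ} (ε δ α : ℝ) (D : Database n d) (ω : Randomness) : ℕ :=
  P.steps (inputEnv D ω) (initState n d ε δ α)

/-- With parameters `ε`, `δ`, `α`, the program `P` is an implementation of the mechanism `M`:
on every database its output has the law that `M` prescribes. -/
def Program.Implements (P : Program) {n d : ℕ} (ε δ α : ℝ) (M : Mechanism n d) : Prop :=
  ∀ D : Database n d, Measurable (P.output ε δ α D) ∧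
    randomnessLaw.map (P.output ε δ α D) = (M D : Measure (Cube d)).map Cube.toReal

end OneWayMarginals

end

open OneWayMarginals

noncomputable section

namespace OneWayMarginals

/-! ### The program -/

/-! Changing one row moves each marginal by at most `2 / n`, so it suffices to add noise whose law
changes little under such shifts and which stays below `α` in every coordinate except with
probability `d ^ (-(log d - 3))`. Clipping to the cube is post-processing and does not move the
output away from the true marginals.

Main case, `log (1 / δ) * log log d < d`. Gaussian noise has the right privacy loss, but the maximum
of `d` samples costs a factor `√(log d)`. Take instead independent coordinates with `P (|Z| > a) =
exp (1 - tail i a)`, where `tail i a = (1 + (2 a + a²) / q) ^ q` and `q = 2 ^ i` lies between `log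
log d` and twice that. At `a = 4 √q` the tail exponent already exceeds `exp (2 q) ≥ (log d)²`
(`exp_le_tail`), so a union bound gives `productNoise_utility` for noise scaled by `α / (4 √q)`. For
privacy, the derivative of the log-density at modulus `a` is of order `(1 + a) * tailBase i a ^ (q -
1)`, hence dominated by the tail exponent. As `E exp (tail / 2)` is finite, the loss has
Gaussian-type exponential moments of every order `l ≥ 1` with `l * s * √q ≤ 1 / 240`, for shifts up
to `s` (`lintegral_exp_mul_loss_le`). Multiplying over coordinates and applying Markov's inequality
yields `pi_noiseLaw_le`. The order needed is about `log (1 / δ) / ε`, and it is admissible exactly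
because of the case assumption (`moment_bounds`).

Other case, `d ≤ log (1 / δ) * log log d`. Then `d ≤ √(d log (1 / δ) log log d)`, so there is room
for a mechanism with `δ = 0` and `n` of order `d / (ε α)`. The noise is uniform on a cube of random
radius `(α / 4) / max U`, with `U` a vector of `d` uniform samples. Enlarging the radius by a factor
`θ = 1 + s / r` absorbs a shift by `s` at the price `θ ^ (2 d)` (`unitBox_prod_cubePoint_le`).

If `log log d ≤ 1`, the exponent `log d - 3` is not positive, and the output `0` will do.

Choosing `q` as a power of two makes the noise samplable with the available operations: its quantile
function uses only logarithms, iterated square roots and arithmetic. -/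

/-- `log log d`. -/
def logLogExpr : RExpr := .log (.log (.ofNat (.reg 1)))

/-- The constant `k` as a real expression. -/
def numeral (k : ℕ) : RExpr := .ofNat (.const k)

/-- Adds the `j`-th column of the database to cell `j` of array `1`, divides by `n`, adds `noise` and
clips the result to `[-1, 1]`; `j` is held by register `2`. -/
def release (noise : RExpr) : Program :=
  .seq (.loop 3 (.reg 0)
    (.setReal 1 (.reg 2) (.add (.read 1 (.reg 2)) (.data (.reg 3) (.reg 2)))))
  (.seq (.setReal 1 (.reg 2) (.add (.div (.read 1 (.reg 2)) (.ofNat (.reg 0))) noise))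
  (.seq (.ifLE (.read 1 (.reg 2)) (.sub (numeral 0) (numeral 1))
      (.setReal 1 (.reg 2) (.sub (numeral 0) (numeral 1))) .skip)
    (.ifLE (numeral 1) (.read 1 (.reg 2)) (.setReal 1 (.reg 2) (numeral 1)) .skip)))

/-- Puts the largest of the samples `d, …, 2d - 1` into cell `0` of array `2`. -/
def maxProgram : Program :=
  .loop 3 (.reg 1) (.ifLE (.read 2 (.const 0)) (.unif (.add (.reg 3) (.reg 1)))
    (.setReal 2 (.const 0) (.unif (.add (.reg 3) (.reg 1)))) .skip)

/-- A uniform sample from `[-1, 1]`, scaled by `α / 4` and divided by cell `0` of array `2`. -/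
def cubeNoiseExpr : RExpr :=
  .div (.mul (.div (.read 0 (.const 2)) (numeral 4))
    (.sub (.mul (numeral 2) (.unif (.reg 2))) (numeral 1))) (.read 2 (.const 0))

/-- Noise from a scale mixture of uniform distributions on the cube. -/
def cubeProgram : Program :=
  .seq maxProgram (.loop 2 (.reg 1) (release cubeNoiseExpr))

/-- Takes square roots of cell `1` of array `2` and doubles cell `0` until the latter is at least
`log log d`. -/
def rootProgram : Program :=
  .loop 3 (.reg 1) (.ifLE logLogExpr (.read 2 (.const 0)) .skip
    (.seq (.setReal 2 (.const 0) (.mul (numeral 2) (.read 2 (.const 0))))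
      (.setReal 2 (.const 1) (.sqrt (.read 2 (.const 1))))))

/-- Samples from the light-tailed noise by inversion of its distribution function. -/
def quantileProgram : Program :=
  .seq (.setReal 2 (.const 0) (numeral 1))
  (.seq (.ifLE (.unif (.reg 2)) (.div (numeral 1) (numeral 2))
    (.setReal 2 (.const 1) (.sub (numeral 1) (.log (.mul (numeral 2) (.unif (.reg 2))))))
    (.setReal 2 (.const 1)
      (.sub (numeral 1) (.log (.sub (numeral 2) (.mul (numeral 2) (.unif (.reg 2))))))))
  (.seq rootProgram
  (.seq (.setReal 2 (.const 1) (.sub (.sqrt (.add (numeral 1) (.mul (.read 2 (.const 0))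
      (.sub (.read 2 (.const 1)) (numeral 1))))) (numeral 1)))
    (.ifLE (.unif (.reg 2)) (.div (numeral 1) (numeral 2))
      (.setReal 2 (.const 1) (.sub (numeral 0) (.read 2 (.const 1)))) .skip))))

/-- The sample in cell `1` of array `2`, scaled by `α / (4 √q)` with `q` in cell `0`. -/
def productNoiseExpr : RExpr :=
  .mul (.div (.read 0 (.const 2)) (.mul (numeral 4) (.sqrt (.read 2 (.const 0)))))
    (.read 2 (.const 1))

/-- Independent light-tailed noise in every coordinate. -/
def productProgram : Program :=
  .loop 2 (.reg 1) (.seq quantileProgram (release productNoiseExpr))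

/-- The program: it outputs `0` if `log log d ≤ 1`, and it uses the scale mixture if and only if
`d ≤ log (1 / δ) * log log d`. -/
def marginalProgram : Program :=
  .ifLE logLogExpr (numeral 1) .skip
    (.ifLE (.ofNat (.reg 1))
      (.mul (.log (.div (numeral 1) (.read 0 (.const 1)))) logLogExpr)
      cubeProgram productProgram)

/-! ### Running time -/

/-- Run with `n`, `d` in the registers `0`, `1`, the program performs at most `B` steps and leaves these
registers unchanged. -/
def StepBound (n d : ℕ) (P : Program) (B : ℕ) : Prop :=
  ∀ E σ, σ.nat 0 = n → σ.nat 1 = d →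
    P.steps E σ ≤ B ∧ (P.exec E σ).nat 0 = n ∧ (P.exec E σ).nat 1 = d

section StepBound

variable {n d : ℕ}

lemma stepBound_skip : StepBound n d .skip 1 := fun _ _ h0 h1 => ⟨le_rfl, h0, h1⟩

lemma stepBound_setReal (a i x) : StepBound n d (.setReal a i x) (i.cost + x.cost + 1) :=
  fun _ _ h0 h1 => ⟨le_rfl, h0, h1⟩

lemma StepBound.seq {s t : Program} {A B : ℕ} (hs : StepBound n d s A) (ht : StepBound n d t B) :
    StepBound n d (.seq s t) (A + B) := fun E σ h0 h1 => by
  obtain ⟨h, h0', h1'⟩ := hs E σ h0 h1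
  obtain ⟨h', h''⟩ := ht E _ h0' h1'
  exact ⟨Nat.add_le_add h h', h''⟩

lemma StepBound.ifLE {s t : Program} {A B : ℕ} (x y : RExpr) (hs : StepBound n d s A)
    (ht : StepBound n d t B) :
    StepBound n d (.ifLE x y s t) (x.cost + y.cost + 1 + (A + B)) := fun E σ h0 h1 => by
  obtain ⟨h, h'⟩ := hs E σ h0 h1
  obtain ⟨k, k'⟩ := ht E σ h0 h1
  simp only [Program.steps, Program.exec]
  split_ifs
  · exact ⟨by omega, h'⟩
  · exact ⟨by omega, k'⟩

lemma iter_induction {I : ℕ → State → Prop} {f : ℕ → State → State} {N : ℕ} {σ : State}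
    (h0 : I 0 σ) (hs : ∀ k < N, ∀ τ, I k τ → I (k + 1) (f k τ)) : I N (iter f N σ) := by
  induction N with
  | zero => exact h0
  | succ N ih => exact hs N N.lt_succ_self _ (ih fun k hk => hs k (hk.trans N.lt_succ_self))

/-- A counter other than registers `0` and `1` keeps `n` and `d` intact, so the bound for the body
applies afresh in each iteration. -/
lemma StepBound.loop {s : Program} {A N : ℕ} {r : ℕ} {e : NExpr} (hr : 2 ≤ r)
    (hs : StepBound n d s A) (he : ∀ σ : State, σ.nat 0 = n → σ.nat 1 = d → e.eval σ = N) :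
    StepBound n d (.loop r e s) (e.cost + 1 + N * (1 + A)) := fun E σ h0 h1 => by
  have hset : ∀ (τ : State) (k : ℕ), τ.nat 0 = n ∧ τ.nat 1 = d →
      (τ.setNat r k).nat 0 = n ∧ (τ.setNat r k).nat 1 = d := fun τ k h => by
    simp only [State.setNat]
    rwa [Function.update_of_ne (by omega), Function.update_of_ne (by omega)]
  have key : ∀ k, (iter (fun l τ => s.exec E (τ.setNat r l)) k σ).nat 0 = n ∧
      (iter (fun l τ => s.exec E (τ.setNat r l)) k σ).nat 1 = d := fun k =>
    iter_induction (I := fun _ τ => τ.nat 0 = n ∧ τ.nat 1 = d) ⟨h0, h1⟩ fun l _ τ h =>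
      (hs E _ (hset τ l h).1 (hset τ l h).2).2
  refine ⟨?_, key _⟩
  simp only [Program.steps, he σ h0 h1]
  gcongr
  calc _ ≤ ∑ k ∈ Finset.range N, (1 + A) := Finset.sum_le_sum fun k _ =>
        Nat.add_le_add_left (hs E _ (hset _ k (key k)).1 (hset _ k (key k)).2).1 1
    _ = _ := by simp

lemma stepBound_release (noise : RExpr) :
    StepBound n d (release noise) (60 + noise.cost + 12 * n) := fun E σ h0 h1 => by
  have h := ((StepBound.loop (n := n) (d := d) (N := n) (r := 3) (e := .reg 0) (by norm_num)
    (stepBound_setReal 1 (.reg 2) (.add (.read 1 (.reg 2)) (.data (.reg 3) (.reg 2))))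
      fun σ h0 _ => h0).seq ((stepBound_setReal 1 (.reg 2)
        (.add (.div (.read 1 (.reg 2)) (.ofNat (.reg 0))) noise)).seq
      (((stepBound_setReal 1 (.reg 2) (.sub (numeral 0) (numeral 1))).ifLE (.read 1 (.reg 2))
        (.sub (numeral 0) (numeral 1)) stepBound_skip).seq
      ((stepBound_setReal 1 (.reg 2) (numeral 1)).ifLE (numeral 1) (.read 1 (.reg 2))
        stepBound_skip)))) E σ h0 h1
  refine ⟨h.1.trans ?_, h.2⟩
  simp only [numeral, RExpr.cost, NExpr.cost]
  omega

lemma stepBound_cubeProgram : StepBound n d cubeProgram (10 + d * (200 + 12 * n)) :=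
  fun E σ h0 h1 => by
  have h := ((StepBound.loop (n := n) (d := d) (N := d) (r := 3) (e := .reg 1) (by norm_num)
    ((stepBound_setReal 2 (.const 0) (.unif (.add (.reg 3) (.reg 1)))).ifLE
      (.read 2 (.const 0)) (.unif (.add (.reg 3) (.reg 1))) stepBound_skip)
      fun σ _ h1 => h1).seq
    (StepBound.loop (n := n) (d := d) (N := d) (r := 2) (e := .reg 1) (by norm_num)
      (stepBound_release cubeNoiseExpr) fun σ _ h1 => h1)) E σ h0 h1
  refine ⟨h.1.trans ?_, h.2⟩
  simp only [cubeNoiseExpr, numeral, RExpr.cost, NExpr.cost]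
  ring_nf
  nlinarith [Nat.zero_le d]

lemma stepBound_rootProgram : StepBound n d rootProgram (2 + 40 * d) := fun E σ h0 h1 => by
  have h := (StepBound.loop (n := n) (d := d) (N := d) (r := 3) (e := .reg 1) (by norm_num)
    (stepBound_skip.ifLE logLogExpr (.read 2 (.const 0))
      ((stepBound_setReal 2 (.const 0) (.mul (numeral 2) (.read 2 (.const 0)))).seq
        (stepBound_setReal 2 (.const 1) (.sqrt (.read 2 (.const 1))))))
      fun σ _ h1 => h1) E σ h0 h1
  refine ⟨h.1.trans ?_, h.2⟩
  simp only [logLogExpr, numeral, RExpr.cost, NExpr.cost]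
  omega

lemma stepBound_quantileProgram : StepBound n d quantileProgram (100 + 40 * d) :=
  fun E σ h0 h1 => by
  have h := ((stepBound_setReal (n := n) (d := d) 2 (.const 0) (numeral 1)).seq
    (((stepBound_setReal 2 (.const 1) (.sub (numeral 1) (.log (.mul (numeral 2)
        (.unif (.reg 2)))))).ifLE (.unif (.reg 2)) (.div (numeral 1) (numeral 2))
      (stepBound_setReal 2 (.const 1) (.sub (numeral 1) (.log (.sub (numeral 2)
        (.mul (numeral 2) (.unif (.reg 2)))))))).seq
    (stepBound_rootProgram.seq ((stepBound_setReal 2 (.const 1)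
      (.sub (.sqrt (.add (numeral 1) (.mul (.read 2 (.const 0))
        (.sub (.read 2 (.const 1)) (numeral 1))))) (numeral 1))).seq
    ((stepBound_setReal 2 (.const 1) (.sub (numeral 0) (.read 2 (.const 1)))).ifLE
      (.unif (.reg 2)) (.div (numeral 1) (numeral 2)) stepBound_skip))))) E σ h0 h1
  refine ⟨h.1.trans ?_, h.2⟩
  simp only [numeral, RExpr.cost, NExpr.cost]
  omega

lemma stepBound_productProgram :
    StepBound n d productProgram (2 + d * (200 + 40 * d + 12 * n)) := fun E σ h0 h1 => by
  have h := (StepBound.loop (n := n) (d := d) (N := d) (r := 2) (e := .reg 1) (by norm_num)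
      (stepBound_quantileProgram.seq (stepBound_release productNoiseExpr))
      fun σ _ h1 => h1) E σ h0 h1
  refine ⟨h.1.trans ?_, h.2⟩
  simp only [productNoiseExpr, numeral, RExpr.cost, NExpr.cost]
  exact Nat.add_le_add le_rfl (Nat.mul_le_mul_left _ (by omega))

lemma stepBound_marginalProgram :
    StepBound n d marginalProgram (100 + d * (400 + 40 * d + 24 * n)) := fun E σ h0 h1 => by
  have h := (stepBound_skip.ifLE logLogExpr (numeral 1)
    (stepBound_cubeProgram.ifLE (.ofNat (.reg 1))
      (.mul (.log (.div (numeral 1) (.read 0 (.const 1)))) logLogExpr)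
      stepBound_productProgram)) E σ h0 h1
  refine ⟨h.1.trans ?_, h.2⟩
  simp only [logLogExpr, numeral, RExpr.cost, NExpr.cost]
  ring_nf
  omega

end StepBound

theorem marginalProgram_runtime_le {n d : ℕ} (hd : 1 ≤ d) (ε δ α : ℝ) (D : Database n d)
    (ω : Randomness) : marginalProgram.runtime ε δ α D ω ≤ 540 * (n + d) ^ 540 := by
  have h := (stepBound_marginalProgram (n := n) (d := d) (inputEnv D ω)
    (initState n d ε δ α) rfl rfl).1
  refine h.trans ?_
  -- `540 = 100 + 400 + 40`, using `1 ≤ d`; the same number serves as the oversized exponent because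
  -- a single `K` plays both roles.
  calc 100 + d * (400 + 40 * d + 24 * n) ≤ 540 * (n + d) ^ 2 := by nlinarith
    _ ≤ 540 * (n + d) ^ 540 := by gcongr <;> omega

section

/-! ### What the program computes -/

/-- The projection of the real line onto `[-1, 1]`. -/
def clip (x : ℝ) : ℝ := max (-1) (min 1 x)

lemma clip_mem (x : ℝ) : clip x ∈ Set.Icc (-1 : ℝ) 1 :=
  ⟨le_max_left _ _, max_le (by norm_num) (min_le_left _ _)⟩

lemma measurable_clip : Measurable clip := by unfold clip; fun_prop

/-- Clipping is 1-Lipschitz and fixes `m`. -/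
lemma abs_clip_add_sub_le {m x : ℝ} (h1 : -1 ≤ m) (h2 : m ≤ 1) : |clip (m + x) - m| ≤ |x| := by
  unfold clip
  rcases abs_cases x with h | h <;> rcases max_cases (-1) (min 1 (m + x)) with h' | h' <;>
    rcases min_cases 1 (m + x) with h'' | h'' <;> rw [abs_le] <;> constructor <;> linarith

lemma ite_ite_eq_clip (x : ℝ) :
    (if (1 : ℝ) ≤ (if x ≤ -1 then -1 else x) then 1 else (if x ≤ -1 then -1 else x)) = clip x := by
  unfold clip
  split_ifs <;> rcases max_cases (-1) (min 1 x) with h' | h' <;>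
    rcases min_cases 1 x with h'' | h'' <;> linarith

/-- The registers and the array that hold the input parameters agree. -/
structure SameContext (σ τ : State) : Prop where
  nat0 : τ.nat 0 = σ.nat 0
  nat1 : τ.nat 1 = σ.nat 1
  real0 : τ.real 0 = σ.real 0

lemma SameContext.trans {σ τ υ : State} (h : SameContext σ τ) (h' : SameContext τ υ) :
    SameContext σ υ :=
  ⟨h'.nat0.trans h.nat0, h'.nat1.trans h.nat1, h'.real0.trans h.real0⟩

lemma SameContext.rfl {σ : State} : SameContext σ σ := ⟨_root_.rfl, _root_.rfl, _root_.rfl⟩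

lemma sameContext_setReal (σ : State) {a : ℕ} (ha : a ≠ 0) (i : ℕ) (x : ℝ) :
    SameContext σ (σ.setReal a i x) :=
  ⟨_root_.rfl, _root_.rfl, by simp [State.setReal, ha.symm]⟩

lemma sameContext_setNat (σ : State) {r : ℕ} (hr : 2 ≤ r) (k : ℕ) :
    SameContext σ (σ.setNat r k) := by
  refine ⟨?_, ?_, _root_.rfl⟩ <;> simp only [State.setNat] <;>
    rw [Function.update_of_ne (by omega)]

@[simp] lemma setNat_real (σ : State) (r k : ℕ) : (σ.setNat r k).real = σ.real := rfl

@[simp] lemma setReal_nat (σ : State) (a i : ℕ) (x : ℝ) : (σ.setReal a i x).nat = σ.nat := rfl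

lemma setNat_nat (σ : State) (r k s : ℕ) :
    (σ.setNat r k).nat s = if s = r then k else σ.nat s := by
  simp [State.setNat, Function.update_apply]

lemma setReal_real (σ : State) (a i : ℕ) (x : ℝ) (b : ℕ) :
    (σ.setReal a i x).real b =
      if b = a then Function.update (σ.real a) i x else σ.real b := by
  simp [State.setReal, Function.update_apply]

variable (E : Env)

/-- As in the later `exec_` lemmas, the final state gets a name `τ`, so that callers can treat it as
opaque and use only the listed facts. -/
lemma exec_columnSum (σ : State) :
    ∃ τ, (Program.loop 3 (.reg 0) (.setReal 1 (.reg 2)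
      (.add (.read 1 (.reg 2)) (.data (.reg 3) (.reg 2))))).exec E σ = τ ∧
      SameContext σ τ ∧ τ.nat 2 = σ.nat 2 ∧ τ.real 2 = σ.real 2 ∧
      τ.real 1 = Function.update (σ.real 1) (σ.nat 2)
        (σ.real 1 (σ.nat 2) + ∑ i ∈ Finset.range (σ.nat 0), E.data i (σ.nat 2)) := by
  refine ⟨_, rfl, ?_⟩
  simp only [Program.exec, NExpr.eval]
  refine iter_induction (I := fun k τ => SameContext σ τ ∧ τ.nat 2 = σ.nat 2 ∧
    τ.real 2 = σ.real 2 ∧ τ.real 1 = Function.update (σ.real 1) (σ.nat 2)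
        (σ.real 1 (σ.nat 2) + ∑ i ∈ Finset.range k, E.data i (σ.nat 2))) ?_ ?_
  · exact ⟨.rfl, rfl, rfl, by simp⟩
  · rintro k - τ ⟨h1, h2, h3, h4⟩
    refine ⟨h1.trans ((sameContext_setNat _ (by norm_num) _).trans
      (sameContext_setReal _ (by norm_num) _ _)), ?_, ?_, ?_⟩
    · simp [setNat_nat, h2]
    · simp [setReal_real, h3]
    · simp [setReal_real, setNat_nat, RExpr.eval, NExpr.eval, h4, h2, Finset.sum_range_succ,
        add_assoc]

/-- The noise expression is evaluated only after the column has been summed, hence `hx` asks for its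
value in every state that agrees on the parameters, the column index and array `2`. By `h0` the
accumulator starts empty. -/
lemma exec_release (noise : RExpr) (x : ℝ) (σ : State)
    (hx : ∀ τ, SameContext σ τ → τ.nat 2 = σ.nat 2 → τ.real 2 = σ.real 2 → noise.eval E τ = x)
    (h0 : σ.real 1 (σ.nat 2) = 0) :
    ∃ τ, (release noise).exec E σ = τ ∧ SameContext σ τ ∧ τ.nat 2 = σ.nat 2 ∧
      τ.real 2 = σ.real 2 ∧ τ.real 1 = Function.update (σ.real 1) (σ.nat 2)
        (clip ((∑ i ∈ Finset.range (σ.nat 0), E.data i (σ.nat 2)) / σ.nat 0 + x)) := by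
  obtain ⟨τ, hτ, h1, h2, h3, h4⟩ := exec_columnSum E σ
  refine ⟨_, rfl, ?_⟩
  rw [← ite_ite_eq_clip]
  have hn := hx τ h1 h2 h3
  set m : ℝ := (∑ i ∈ Finset.range (σ.nat 0), E.data i (σ.nat 2)) / σ.nat 0 with hm
  rw [release, Program.exec, hτ]
  simp only [Program.exec, RExpr.eval, NExpr.eval, numeral, hn, Nat.cast_one]
  by_cases c1 : m + x ≤ -1
  · simp [setReal_real, h4, h2, h1.nat0, h0, ← hm, c1]
    norm_num
    exact ⟨(h1.trans ⟨rfl, rfl, by simp [setReal_real]⟩), h2, by simpa [setReal_real] using h3,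
      by simp [setReal_real, h4]⟩
  · by_cases c2 : 1 ≤ m + x
    · simp [setReal_real, h4, h2, h1.nat0, h0, ← hm, c1, c2]
      exact ⟨(h1.trans ⟨rfl, rfl, by simp [setReal_real]⟩), by simpa [setReal_real] using h3⟩
    · simp [setReal_real, h4, h2, h1.nat0, h0, ← hm, c1, c2]
      exact ⟨(h1.trans ⟨rfl, rfl, by simp [setReal_real]⟩), by simpa [setReal_real] using h3⟩

/-- A loop over the columns whose body writes the value `out j` to cell `j`. -/
lemma exec_columnLoop (s : Program) (σ : State) (I : State → Prop) (out : ℕ → ℝ)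
    (h0 : σ.real 1 = 0) (hI : I σ)
    (hs : ∀ τ k, SameContext σ τ → I τ → τ.real 1 k = 0 →
      ∃ υ, s.exec E (τ.setNat 2 k) = υ ∧ SameContext σ υ ∧ I υ ∧
        υ.real 1 = Function.update (τ.real 1) k (out k)) :
    ((Program.loop 2 (.reg 1) s).exec E σ).real 1 = fun i => if i < σ.nat 1 then out i else 0 := by
  simp only [Program.exec, NExpr.eval]
  refine (iter_induction (I := fun k τ => SameContext σ τ ∧ I τ ∧
    τ.real 1 = fun i => if i < k then out i else 0) ?_ ?_).2.2
  · exact ⟨.rfl, hI, by ext i; simp [h0]⟩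
  · rintro k - τ ⟨h1, h2, h3⟩
    obtain ⟨υ, rfl, h4, h5, h6⟩ := hs τ k h1 h2 (by simp [h3])
    refine ⟨h4, h5, ?_⟩
    rw [h6, h3]
    ext i
    rcases lt_trichotomy i k with h | rfl | h
    · simp [h, h.ne, h.trans]
    · simp
    · simp [h.ne', h.not_gt, show ¬ i < k + 1 by omega]

/-- The maximum of `0` and `f 0, …, f (k - 1)`. -/
def runningMax (f : ℕ → ℝ) : ℕ → ℝ
  | 0 => 0
  | k + 1 => max (runningMax f k) (f k)

lemma exec_maxProgram (σ : State) (h2 : σ.real 2 0 = 0) :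
    ∃ τ, maxProgram.exec E σ = τ ∧ SameContext σ τ ∧ τ.real 1 = σ.real 1 ∧
      τ.real 2 0 = runningMax (fun i => (E.rand.1 (i + σ.nat 1) : ℝ)) (σ.nat 1) := by
  refine ⟨_, rfl, ?_⟩
  simp only [maxProgram, Program.exec, NExpr.eval]
  refine iter_induction (I := fun k τ => SameContext σ τ ∧ τ.real 1 = σ.real 1 ∧
    τ.real 2 0 = runningMax (fun i => (E.rand.1 (i + σ.nat 1) : ℝ)) k) ?_ ?_
  · exact ⟨.rfl, rfl, h2⟩
  · rintro k - τ ⟨h1, h3, h4⟩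
    have hc : SameContext σ (τ.setNat 3 k) := h1.trans (sameContext_setNat _ (by norm_num) _)
    have e1 : (τ.setNat 3 k).nat 1 = σ.nat 1 := hc.nat1
    have e3 : (τ.setNat 3 k).nat 3 = k := by simp [setNat_nat]
    simp only [RExpr.eval, NExpr.eval, e1, e3, setNat_real, h4]
    split_ifs with h
    · refine ⟨hc.trans (sameContext_setReal _ (by norm_num) _ _), ?_, ?_⟩
      · simp [setReal_real, h3]
      · simp [setReal_real, runningMax, h]
    · exact ⟨hc, h3, by rw [setNat_real, h4, runningMax, max_eq_left (le_of_not_ge h)]⟩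

/-- The number of the first doublings of `1`, out of `k`, up to which the value is below `L`. -/
def doublings (L : ℝ) : ℕ → ℕ
  | 0 => 0
  | k + 1 => if L ≤ 2 ^ doublings L k then doublings L k else doublings L k + 1

lemma exec_rootProgram (σ : State) (h0 : σ.real 2 0 = 1) :
    ∃ τ, rootProgram.exec E σ = τ ∧ SameContext σ τ ∧ τ.nat 2 = σ.nat 2 ∧ τ.real 1 = σ.real 1 ∧
      τ.real 2 0 = 2 ^ doublings (Real.log (Real.log (σ.nat 1))) (σ.nat 1) ∧
      τ.real 2 1 =
        Real.sqrt^[doublings (Real.log (Real.log (σ.nat 1))) (σ.nat 1)] (σ.real 2 1) := by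
  refine ⟨_, rfl, ?_⟩
  simp only [rootProgram, Program.exec, NExpr.eval]
  refine iter_induction (I := fun k τ => SameContext σ τ ∧ τ.nat 2 = σ.nat 2 ∧
    τ.real 1 = σ.real 1 ∧
      τ.real 2 0 = 2 ^ doublings (Real.log (Real.log (σ.nat 1))) k ∧
      τ.real 2 1 = Real.sqrt^[doublings (Real.log (Real.log (σ.nat 1))) k] (σ.real 2 1)) ?_ ?_
  · exact ⟨.rfl, rfl, rfl, by simpa [doublings] using h0, rfl⟩
  · rintro k - τ ⟨h1, h2, h3, h4, h5⟩
    have hc : SameContext σ (τ.setNat 3 k) := h1.trans (sameContext_setNat _ (by norm_num) _)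
    have e1 : (τ.setNat 3 k).nat 1 = σ.nat 1 := hc.nat1
    have e2 : (τ.setNat 3 k).nat 2 = σ.nat 2 := by simp [setNat_nat, h2]
    simp only [RExpr.eval, NExpr.eval, e1, setNat_real, h4, logLogExpr, doublings]
    split_ifs with h
    · exact ⟨hc, e2, h3, h4, h5⟩
    · refine ⟨hc.trans ((sameContext_setReal _ (by norm_num) _ _).trans
        (sameContext_setReal _ (by norm_num) _ _)), e2, ?_, ?_, ?_⟩
      · simp [setReal_real, h3]
      · simp [setReal_real, numeral, RExpr.eval, NExpr.eval, pow_succ, mul_comm]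
      · simp [setReal_real, h5, Function.iterate_succ_apply', -Function.iterate_succ]

/-- The inverse of `a ↦ (1 + (2 a + a ^ 2) / 2 ^ i) ^ (2 ^ i)` on the nonnegative reals. -/
def tailRoot (i : ℕ) (x : ℝ) : ℝ := Real.sqrt (1 + 2 ^ i * (Real.sqrt^[i] x - 1)) - 1

/-- The quantile function of the light-tailed noise with parameter `2 ^ i`. -/
def quantile (i : ℕ) (u : ℝ) : ℝ :=
  if u ≤ 1 / 2 then -tailRoot i (1 - Real.log (2 * u)) else tailRoot i (1 - Real.log (2 - 2 * u))

lemma exec_quantileProgram (σ : State) :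
    ∃ τ, quantileProgram.exec E σ = τ ∧ SameContext σ τ ∧ τ.nat 2 = σ.nat 2 ∧
      τ.real 1 = σ.real 1 ∧
      τ.real 2 0 = 2 ^ doublings (Real.log (Real.log (σ.nat 1))) (σ.nat 1) ∧
      τ.real 2 1 = quantile (doublings (Real.log (Real.log (σ.nat 1))) (σ.nat 1))
        (E.rand.1 (σ.nat 2)) := by
  refine ⟨_, rfl, ?_⟩
  have hneg : ∀ x : ℝ, ((0 : ℕ) : ℝ) - x = -x := by simp
  simp only [quantileProgram, Program.exec, RExpr.eval, NExpr.eval, numeral, hneg, Nat.cast_one,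
    Nat.cast_ofNat, setReal_nat]
  by_cases h : (E.rand.1 (σ.nat 2) : ℝ) ≤ 1 / 2
  · rw [if_pos h]
    obtain ⟨τ, hτ, h1, h2, h3, h4, h5⟩ := exec_rootProgram E
      ((σ.setReal 2 0 1).setReal 2 1 (1 - Real.log (2 * (E.rand.1 (σ.nat 2) : ℝ))))
      (by simp [setReal_real])
    simp only [setReal_nat] at h2 h4 h5
    rw [hτ, h2, if_pos h]
    refine ⟨(((sameContext_setReal _ (by norm_num) _ _).trans
      (sameContext_setReal _ (by norm_num) _ _)).trans h1).trans
      ((sameContext_setReal _ (by norm_num) _ _).trans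
      (sameContext_setReal _ (by norm_num) _ _)), h2, ?_, ?_, ?_⟩
    · simp [setReal_real, h3]
    · simp [setReal_real, h4]
    · simp [setReal_real, h4, h5, quantile, tailRoot, h, -one_div]
  · rw [if_neg h]
    obtain ⟨τ, hτ, h1, h2, h3, h4, h5⟩ := exec_rootProgram E
      ((σ.setReal 2 0 1).setReal 2 1 (1 - Real.log (2 - 2 * (E.rand.1 (σ.nat 2) : ℝ))))
      (by simp [setReal_real])
    simp only [setReal_nat] at h2 h4 h5
    rw [hτ, h2, if_neg h]
    refine ⟨(((sameContext_setReal _ (by norm_num) _ _).trans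
      (sameContext_setReal _ (by norm_num) _ _)).trans h1).trans
      (sameContext_setReal _ (by norm_num) _ _), h2, ?_, ?_, ?_⟩
    · simp [setReal_real, h3]
    · simp [setReal_real, h4]
    · simp [setReal_real, h4, h5, quantile, tailRoot, h, -one_div]

variable {E} {n d : ℕ}

/-- The noise of `cubeProgram`. -/
def cubeNoise (d : ℕ) (α : ℝ) (ω : Randomness) (j : ℕ) : ℝ :=
  α / 4 * (2 * (ω.1 j : ℝ) - 1) / runningMax (fun i => (ω.1 (i + d) : ℝ)) d

/-- The noise of `productProgram`. -/
def productNoise (d : ℕ) (α : ℝ) (ω : Randomness) (j : ℕ) : ℝ :=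
  α / (4 * Real.sqrt (2 ^ doublings (Real.log (Real.log d)) d)) *
    quantile (doublings (Real.log (Real.log d)) d) (ω.1 j)

lemma exec_cubeProgram (σ : State) (h1 : σ.real 1 = 0) (h2 : σ.real 2 0 = 0) :
    (cubeProgram.exec E σ).real 1 = fun j => if j < σ.nat 1 then
      clip ((∑ i ∈ Finset.range (σ.nat 0), E.data i j) / σ.nat 0 +
        cubeNoise (σ.nat 1) (σ.real 0 2) E.rand j) else 0 := by
  obtain ⟨τ, hτ, hc, h3, h4⟩ := exec_maxProgram E σ h2
  rw [cubeProgram, Program.exec, hτ, exec_columnLoop E _ τ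
    (fun υ => υ.real 2 0 = runningMax (fun i => (E.rand.1 (i + σ.nat 1) : ℝ)) (σ.nat 1))
    (fun j => clip ((∑ i ∈ Finset.range (σ.nat 0), E.data i j) / σ.nat 0 +
        cubeNoise (σ.nat 1) (σ.real 0 2) E.rand j)) (h3.trans h1) h4, hc.nat1]
  intro υ k hυ hI h0
  obtain ⟨φ, hφ, h5, h6, h7, h8⟩ := exec_release E cubeNoiseExpr
    (cubeNoise (σ.nat 1) (σ.real 0 2) E.rand k) (υ.setNat 2 k) (by
      intro φ h5 h6 h7
      have := (hc.trans (hυ.trans ((sameContext_setNat υ (le_refl 2) k).trans h5))).real0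
      simp [cubeNoiseExpr, RExpr.eval, NExpr.eval, numeral, h6, h7, this, hI, setNat_nat,
        cubeNoise]) (by simp [setNat_nat, h0])
  refine ⟨φ, hφ, hυ.trans ((sameContext_setNat υ (le_refl 2) k).trans h5), by rw [h7]; exact hI, ?_⟩
  rw [h8]
  simp [setNat_nat, hυ.nat0, hc.nat0]

lemma exec_productProgram (σ : State) (h1 : σ.real 1 = 0) :
    (productProgram.exec E σ).real 1 = fun j => if j < σ.nat 1 then
      clip ((∑ i ∈ Finset.range (σ.nat 0), E.data i j) / σ.nat 0 +
        productNoise (σ.nat 1) (σ.real 0 2) E.rand j) else 0 := by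
  rw [productProgram, exec_columnLoop E _ σ (fun _ => True)
    (fun j => clip ((∑ i ∈ Finset.range (σ.nat 0), E.data i j) / σ.nat 0 +
        productNoise (σ.nat 1) (σ.real 0 2) E.rand j)) h1 trivial]
  rintro υ k hυ - h0
  obtain ⟨χ, hχ, g1, g2, g3, g4, g5⟩ := exec_quantileProgram E (υ.setNat 2 k)
  have hc : SameContext σ χ := hυ.trans ((sameContext_setNat υ (le_refl 2) k).trans g1)
  have gk : χ.nat 2 = k := by rw [g2]; simp [setNat_nat]
  have e1 : (υ.setNat 2 k).nat 1 = σ.nat 1 := by rw [← hυ.nat1]; simp [setNat_nat]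
  rw [e1] at g4 g5
  obtain ⟨φ, hφ, h5, h6, h7, h8⟩ := exec_release E productNoiseExpr
    (productNoise (σ.nat 1) (σ.real 0 2) E.rand k) χ (by
      intro φ h5 h6 h7
      have := (hc.trans h5).real0
      simp only [productNoiseExpr, RExpr.eval, NExpr.eval, numeral, h7, this, g4, g5, productNoise,
        Nat.cast_ofNat]
      simp [setNat_nat]) (by rw [gk, g3]; exact h0)
  refine ⟨φ, by rw [Program.exec, hχ, hφ], hc.trans h5, trivial, ?_⟩
  rw [h8, gk, g3, hc.nat0]
  rfl

lemma sum_data_inputEnv (D : Database n d) (ω : Randomness) (j : Fin d) :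
    (∑ i ∈ Finset.range n, (inputEnv D ω).data i j) / n = marginals D j := by
  rw [marginals, one_div, inv_mul_eq_div, Finset.sum_range]
  simp [inputEnv]

/-- The noise vector of the program, for the inputs on which it does not return `0`. -/
def noise (d : ℕ) (δ α : ℝ) (ω : Randomness) (j : ℕ) : ℝ :=
  if (d : ℝ) ≤ Real.log (1 / δ) * Real.log (Real.log d) then cubeNoise d α ω j
    else productNoise d α ω j

theorem output_marginalProgram (ε δ α : ℝ) (D : Database n d) (ω : Randomness) :
    marginalProgram.output ε δ α D ω = if Real.log (Real.log d) ≤ 1 then 0 else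
      fun j => clip (marginals D j + noise d δ α ω j) := by
  funext j
  have hs : ∀ j : Fin d, (∑ i ∈ Finset.range ((initState n d ε δ α).nat 0),
      (inputEnv D ω).data i j) / ((initState n d ε δ α).nat 0 : ℝ) = marginals D j :=
    fun j => sum_data_inputEnv D ω j
  have h1 : (initState n d ε δ α).real 1 = 0 := by ext; simp [initState]
  rw [Program.output, marginalProgram, Program.exec]
  simp only [logLogExpr, numeral, RExpr.eval, NExpr.eval, Nat.cast_one, Program.exec]
  rw [show (initState n d ε δ α).nat 1 = d from rfl,
    show (initState n d ε δ α).real 0 1 = δ from rfl]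
  split_ifs with c1 c2
  · simp [initState]
  · rw [exec_cubeProgram _ h1 (by simp [initState])]
    simp only [hs, noise, if_pos c2]
    rw [show (initState n d ε δ α).nat 1 = d from rfl, if_pos j.2]
    rfl
  · rw [exec_productProgram _ h1]
    simp only [hs, noise, if_neg c2]
    rw [show (initState n d ε δ α).nat 1 = d from rfl, if_pos j.2]
    rfl

end

/-! ### The light-tailed noise distribution -/

/-- The base of the power in `tail`. -/
def tailBase (i : ℕ) (a : ℝ) : ℝ := 1 + (2 * a + a ^ 2) / 2 ^ i

/-- A light-tailed noise variable `Z` has `P (|Z| > a) = exp (1 - tail i a)`. -/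
def tail (i : ℕ) (a : ℝ) : ℝ := tailBase i a ^ 2 ^ i

lemma sqrt_iterate_pow (i : ℕ) {x : ℝ} (hx : 0 ≤ x) : (Real.sqrt^[i] x) ^ 2 ^ i = x := by
  induction i generalizing x with
  | zero => simp
  | succ i ih => rw [Function.iterate_succ_apply, pow_succ, pow_mul, ih (Real.sqrt_nonneg x),
      Real.sq_sqrt hx]

lemma sqrt_iterate_of_pow (i : ℕ) {y : ℝ} (hy : 0 ≤ y) : Real.sqrt^[i] (y ^ 2 ^ i) = y := by
  induction i generalizing y with
  | zero => simp
  | succ i ih => rw [Function.iterate_succ_apply, pow_succ, pow_mul,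
      Real.sqrt_sq (pow_nonneg hy _), ih hy]

lemma one_le_sqrt_iterate (i : ℕ) {x : ℝ} (hx : 1 ≤ x) : 1 ≤ Real.sqrt^[i] x := by
  induction i generalizing x with
  | zero => simpa
  | succ i ih => exact ih (Real.one_le_sqrt.2 hx)

lemma one_le_tailBase (i : ℕ) {a : ℝ} (ha : 0 ≤ a) : 1 ≤ tailBase i a := by
  have : 0 ≤ (2 * a + a ^ 2) / 2 ^ i := by positivity
  unfold tailBase; linarith

lemma one_le_tail (i : ℕ) {a : ℝ} (ha : 0 ≤ a) : 1 ≤ tail i a :=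
  one_le_pow₀ (one_le_tailBase i ha)

/-- Completing the square, `1 + 2 ^ i * (tailBase i a - 1) = (1 + a) ^ 2`; this is why `tailBase`
contains `2 * a + a ^ 2`. -/
lemma tailRoot_tail (i : ℕ) {a : ℝ} (ha : 0 ≤ a) : tailRoot i (tail i a) = a := by
  rw [tailRoot, tail, sqrt_iterate_of_pow i (zero_le_one.trans (one_le_tailBase i ha)), tailBase,
    show 1 + 2 ^ i * (1 + (2 * a + a ^ 2) / 2 ^ i - 1) = (1 + a) ^ 2 by field_simp; ring,
    Real.sqrt_sq (by linarith)]
  ring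

lemma tailRoot_nonneg (i : ℕ) {x : ℝ} (hx : 1 ≤ x) : 0 ≤ tailRoot i x := by
  have h := one_le_sqrt_iterate i hx
  rw [tailRoot, sub_nonneg, Real.one_le_sqrt]
  have : 0 ≤ 2 ^ i * (Real.sqrt^[i] x - 1) := by
    have : 0 ≤ Real.sqrt^[i] x - 1 := by linarith
    positivity
  linarith

lemma tail_tailRoot (i : ℕ) {x : ℝ} (hx : 1 ≤ x) : tail i (tailRoot i x) = x := by
  have h := one_le_sqrt_iterate i hx
  have h' : 0 ≤ 1 + 2 ^ i * (Real.sqrt^[i] x - 1) := by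
    have : 0 ≤ Real.sqrt^[i] x - 1 := by linarith
    positivity
  have hb : tailBase i (tailRoot i x) = Real.sqrt^[i] x := by
    have e : 2 * tailRoot i x + tailRoot i x ^ 2 = 2 ^ i * (Real.sqrt^[i] x - 1) := by
      have := Real.sq_sqrt h'
      rw [tailRoot]
      linear_combination this
    rw [tailBase, e]
    field_simp
    ring
  rw [tail, hb, sqrt_iterate_pow i (by linarith)]

lemma tail_zero (i : ℕ) : tail i 0 = 1 := by simp [tail, tailBase]

lemma one_lt_tail (i : ℕ) {a : ℝ} (ha : 0 < a) : 1 < tail i a := by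
  have : 0 < (2 * a + a ^ 2) / 2 ^ i := by positivity
  exact one_lt_pow₀ (by unfold tailBase; linarith) (by positivity)

lemma tailRoot_pos (i : ℕ) {x : ℝ} (hx : 1 < x) : 0 < tailRoot i x := by
  refine lt_of_le_of_ne (tailRoot_nonneg i hx.le) fun h => hx.ne ?_
  rw [← tail_tailRoot i hx.le, ← h, tail_zero]

/-- The distribution function of the light-tailed noise. -/
def noiseCdf (i : ℕ) (x : ℝ) : ℝ :=
  if x ≤ 0 then Real.exp (1 - tail i (-x)) / 2 else 1 - Real.exp (1 - tail i x) / 2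

lemma noiseCdf_mem (i : ℕ) (x : ℝ) : noiseCdf i x ∈ Set.Ioo (0 : ℝ) 1 := by
  have key : ∀ a, 0 ≤ a → Real.exp (1 - tail i a) ≤ 1 := fun a ha =>
    Real.exp_le_one_iff.2 (by linarith [one_le_tail i ha])
  unfold noiseCdf
  split_ifs with h
  · have := key (-x) (by linarith)
    exact ⟨by positivity, by linarith⟩
  · have := key x (by linarith)
    have := Real.exp_pos (1 - tail i x)
    constructor <;> linarith

lemma quantile_noiseCdf (i : ℕ) (x : ℝ) : quantile i (noiseCdf i x) = x := by
  unfold noiseCdf quantile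
  split_ifs with h h' h'
  · rw [mul_div_cancel₀ _ two_ne_zero, Real.log_exp, sub_sub_cancel,
      tailRoot_tail i (by linarith), neg_neg]
  · exact absurd (div_le_div_of_nonneg_right (Real.exp_le_one_iff.2
      (by linarith [one_le_tail i (neg_nonneg.2 h)])) zero_le_two) h'
  · have : Real.exp (1 - tail i x) < 1 :=
      Real.exp_lt_one_iff.2 (by linarith [one_lt_tail i (not_le.1 h)])
    linarith
  · rw [show 2 - 2 * (1 - Real.exp (1 - tail i x) / 2) = Real.exp (1 - tail i x) by ring,
      Real.log_exp, sub_sub_cancel, tailRoot_tail i (by linarith)]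

lemma noiseCdf_quantile (i : ℕ) {u : ℝ} (hu : u ∈ Set.Ioo (0 : ℝ) 1) :
    noiseCdf i (quantile i u) = u := by
  obtain ⟨h0, h1⟩ := hu
  unfold quantile
  split_ifs with h
  · have hl : 1 ≤ 1 - Real.log (2 * u) := by
      linarith [Real.log_nonpos (by linarith : 0 ≤ 2 * u) (by linarith)]
    rw [noiseCdf, if_pos (neg_nonpos.2 (tailRoot_nonneg i hl)), neg_neg, tail_tailRoot i hl,
      sub_sub_cancel, Real.exp_log (by linarith)]
    ring
  · have hl : 1 < 1 - Real.log (2 - 2 * u) := by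
      linarith [Real.log_neg (by linarith : 0 < 2 - 2 * u) (by linarith)]
    rw [noiseCdf, if_neg (not_le.2 (tailRoot_pos i hl)), tail_tailRoot i hl.le,
      sub_sub_cancel, Real.exp_log (by linarith)]
    ring

/-- The logarithm of the noise density, as a function of the modulus. -/
def radialLogDensity (i : ℕ) (a : ℝ) : ℝ :=
  Real.log (1 + a) + ((2 ^ i - 1 : ℕ) : ℝ) * Real.log (tailBase i a) + 1 - tail i a

/-- The logarithm of the noise density. -/
def logDensity (i : ℕ) (x : ℝ) : ℝ := radialLogDensity i |x|

lemma exp_radialLogDensity (i : ℕ) {a : ℝ} (ha : 0 ≤ a) : Real.exp (radialLogDensity i a) =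
    (1 + a) * tailBase i a ^ (2 ^ i - 1) * Real.exp (1 - tail i a) := by
  have := one_le_tailBase i ha
  rw [radialLogDensity, add_sub_assoc, Real.exp_add, Real.exp_add, Real.exp_log (by linarith),
    mul_comm (_ : ℝ) (Real.log _), Real.exp_mul, Real.exp_log (by linarith), Real.rpow_natCast]

lemma hasDerivAt_tailBase (i : ℕ) (a : ℝ) :
    HasDerivAt (tailBase i) (2 * (1 + a) / 2 ^ i) a := by
  unfold tailBase
  have := ((((hasDerivAt_id a).const_mul 2).add ((hasDerivAt_id a).pow 2)).div_const
    (2 ^ i)).const_add 1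
  refine this.congr_deriv ?_
  simp; ring

lemma hasDerivAt_tail (i : ℕ) (a : ℝ) :
    HasDerivAt (tail i) (2 * (1 + a) * tailBase i a ^ (2 ^ i - 1)) a := by
  refine ((hasDerivAt_tailBase i a).pow (2 ^ i)).congr_deriv ?_
  push_cast
  field_simp

/-- Leaving out `0` avoids gluing the two branches; a single point is negligible in the change of
variables below. -/
lemma hasDerivAt_noiseCdf (i : ℕ) {x : ℝ} (hx : x ≠ 0) :
    HasDerivAt (noiseCdf i) (Real.exp (logDensity i x)) x := by
  rw [logDensity, exp_radialLogDensity i (abs_nonneg x)]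
  rcases hx.lt_or_gt with h | h
  · have hd : HasDerivAt (fun x => Real.exp (1 - tail i (-x)) / 2) _ x :=
      ((((hasDerivAt_tail i (-x)).comp x (hasDerivAt_neg x)).const_sub 1).exp).div_const 2
    rw [abs_of_neg h]
    refine (hd.congr_of_eventuallyEq ?_).congr_deriv ?_
    · filter_upwards [Iio_mem_nhds h] with y hy
      simp [noiseCdf, (Set.mem_Iio.1 hy).le]
    · simp only [Function.comp_apply]; ring
  · have hd : HasDerivAt (fun x => 1 - Real.exp (1 - tail i x) / 2) _ x :=
      ((((hasDerivAt_tail i x).const_sub 1).exp).div_const 2).const_sub 1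
    rw [abs_of_pos h]
    refine (hd.congr_of_eventuallyEq ?_).congr_deriv ?_
    · filter_upwards [Ioi_mem_nhds h] with y hy
      simp [noiseCdf, not_le.2 (Set.mem_Ioi.1 hy)]
    · ring

lemma measurable_quantile (i : ℕ) : Measurable (quantile i) := by
  have h : Measurable (tailRoot i) := by
    have := Real.continuous_sqrt.measurable.iterate i
    unfold tailRoot
    fun_prop
  exact Measurable.ite measurableSet_Iic (by fun_prop) (by fun_prop)

lemma measurable_logDensity (i : ℕ) : Measurable (logDensity i) := by
  unfold logDensity radialLogDensity tail tailBase
  fun_prop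

/-- The law of the light-tailed noise. -/
def noiseLaw (i : ℕ) : Measure ℝ :=
  volume.withDensity fun x => ENNReal.ofReal (Real.exp (logDensity i x))

/-- Inverse transform sampling: on the open unit interval the preimage of `S` under the quantile
function is the image of `S` under the distribution function, and the change of variables formula
turns its volume into the integral of the derivative. -/
theorem map_quantile (i : ℕ) :
    (volume.restrict (Set.Ioo (0 : ℝ) 1)).map (quantile i) = noiseLaw i := by
  ext S hS
  rw [Measure.map_apply (measurable_quantile i) hS,
    Measure.restrict_apply (measurable_quantile i hS), noiseLaw, withDensity_apply _ hS]
  have himg : quantile i ⁻¹' S ∩ Set.Ioo 0 1 = noiseCdf i '' S := by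
    ext u
    constructor
    · rintro ⟨h1, h2⟩
      exact ⟨_, h1, noiseCdf_quantile i h2⟩
    · rintro ⟨x, hx, rfl⟩
      exact ⟨by simpa [quantile_noiseCdf] using hx, noiseCdf_mem i x⟩
  have hae : (S \ {0} : Set ℝ) =ᵐ[volume] S :=
    sdiff_null_ae_eq_self (by simp)
  have hinj : Function.Injective (noiseCdf i) :=
    Function.LeftInverse.injective (quantile_noiseCdf i)
  have himg' : (noiseCdf i '' (S \ {0}) : Set ℝ) =ᵐ[volume] noiseCdf i '' S := by
    rw [Set.image_sdiff hinj]
    exact sdiff_null_ae_eq_self (by simp)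
  rw [himg, ← measure_congr himg', ← setLIntegral_one,
    lintegral_image_eq_lintegral_abs_deriv_mul (hS.diff (measurableSet_singleton 0))
      (fun x hx => (hasDerivAt_noiseCdf i hx.2).hasDerivWithinAt)
      hinj.injOn, setLIntegral_congr hae]
  simp [abs_of_pos (Real.exp_pos _)]

instance (i : ℕ) : IsProbabilityMeasure (noiseLaw i) := by
  rw [← map_quantile]
  have : IsProbabilityMeasure (volume.restrict (Set.Ioo (0 : ℝ) 1)) := ⟨by simp⟩
  exact Measure.isProbabilityMeasure_map (measurable_quantile i).aemeasurable

/-! ### The privacy loss in one coordinate -/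

/-- Bernoulli's inequality: the linear term of the power is `2 * a + a ^ 2`. -/
lemma sq_one_add_le_tail (i : ℕ) {a : ℝ} (ha : 0 ≤ a) : (1 + a) ^ 2 ≤ tail i a := by
  have h : -2 ≤ (2 * a + a ^ 2) / 2 ^ i := by
    have : 0 ≤ (2 * a + a ^ 2) / 2 ^ i := by positivity
    linarith
  have := one_add_mul_le_pow h (2 ^ i)
  push_cast at this
  rw [mul_div_cancel₀ _ (by positivity)] at this
  unfold tail tailBase
  linarith

/-- With `q = 2 ^ i ≥ 2`, `q * tailBase = q - 1 + (1 + a) ^ 2` is at least `√q * (1 + a)` by the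
inequality of the means. The bound trades a factor `1 + a` in the loss for the one missing factor in
`tailBase ^ (q - 1)`. -/
lemma mul_le_tailBase {i : ℕ} (hi : 1 ≤ i) {a c : ℝ} (ha : 0 ≤ a)
    (hc : c * Real.sqrt (2 ^ i) ≤ 1) : c * (1 + a) ≤ tailBase i a := by
  have h2 : (2 : ℝ) ≤ 2 ^ i := by simpa using pow_le_pow_right₀ (one_le_two (α := ℝ)) hi
  set q : ℝ := 2 ^ i
  have hr := Real.sq_sqrt (by linarith : (0 : ℝ) ≤ q)
  have hr0 := Real.sqrt_nonneg q
  set r := Real.sqrt q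
  have e : tailBase i a = (q - 1 + (1 + a) ^ 2) / q := by
    rw [tailBase]; field_simp; ring
  rw [e, le_div_iff₀ (by linarith)]
  have h1 : c * (1 + a) * q ≤ r * (1 + a) := by
    have := mul_le_mul_of_nonneg_right hc (by positivity : 0 ≤ r * (1 + a))
    calc c * (1 + a) * q = c * r * (r * (1 + a)) := by rw [← hr]; ring
      _ ≤ _ := by linarith
  nlinarith [sq_nonneg (r - (1 + a))]

lemma hasDerivAt_radialLogDensity (i : ℕ) {a : ℝ} (ha : 0 ≤ a) :
    HasDerivAt (radialLogDensity i) (1 / (1 + a) + ((2 ^ i - 1 : ℕ) : ℝ) *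
      (2 * (1 + a) / 2 ^ i / tailBase i a) - 2 * (1 + a) * tailBase i a ^ (2 ^ i - 1)) a := by
  have h := one_le_tailBase i ha
  exact (((((hasDerivAt_id a).const_add 1).log (by simp; linarith)).add
    (((hasDerivAt_tailBase i a).log (by linarith)).const_mul _)).add_const 1).sub
    (hasDerivAt_tail i a)

lemma abs_deriv_radialLogDensity_le (i : ℕ) {a : ℝ} (ha : 0 ≤ a) :
    |1 / (1 + a) + ((2 ^ i - 1 : ℕ) : ℝ) * (2 * (1 + a) / 2 ^ i / tailBase i a) -
      2 * (1 + a) * tailBase i a ^ (2 ^ i - 1)| ≤ 5 * ((1 + a) * tailBase i a ^ (2 ^ i - 1)) := by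
  have h := one_le_tailBase i ha
  have hp : 1 ≤ tailBase i a ^ (2 ^ i - 1) := one_le_pow₀ h
  have h1 : 1 / (1 + a) ≤ 1 := by rw [div_le_one (by linarith)]; linarith
  have h1' : 0 ≤ 1 / (1 + a) := by positivity
  have h2 : ((2 ^ i - 1 : ℕ) : ℝ) * (2 * (1 + a) / 2 ^ i / tailBase i a) ≤ 2 * (1 + a) := by
    have hq : ((2 ^ i - 1 : ℕ) : ℝ) ≤ 2 ^ i := by exact_mod_cast Nat.sub_le _ _
    calc _ ≤ (2 : ℝ) ^ i * (2 * (1 + a) / 2 ^ i / 1) := by gcongr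
      _ = _ := by field_simp
  have h2' : 0 ≤ ((2 ^ i - 1 : ℕ) : ℝ) * (2 * (1 + a) / 2 ^ i / tailBase i a) := by positivity
  rw [abs_le]
  constructor <;> nlinarith [mul_le_mul_of_nonneg_left hp (by linarith : 0 ≤ 1 + a)]

/-- Mean value inequality. A step of length `s` multiplies `tailBase` by at most `1 + 1 / q`, hence
its power by at most `e < 3`, so the derivative bound at `a` persists up to a constant: `30 = 5 * 2
* 3`, where `2` accounts for the factor `1 + a`. -/
lemma abs_radialLogDensity_sub_le {i : ℕ} (hi : 1 ≤ i) {a b s : ℝ} (ha : 0 ≤ a) (hb : 0 ≤ b)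
    (hab : |b - a| ≤ s) (hs : s * Real.sqrt (2 ^ i) ≤ 1 / 4) :
    |radialLogDensity i b - radialLogDensity i a| ≤
      |b - a| * (30 * ((1 + a) * tailBase i a ^ (2 ^ i - 1))) := by
  have hs0 : 0 ≤ s := (abs_nonneg _).trans hab
  have h2 : (2 : ℝ) ≤ 2 ^ i := by simpa using pow_le_pow_right₀ (one_le_two (α := ℝ)) hi
  have hr1 : 1 ≤ Real.sqrt (2 ^ i) := Real.one_le_sqrt.2 (by linarith)
  have hs1 : s ≤ 1 / 4 := by nlinarith
  have hQ := one_le_tailBase i ha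
  have hbase : tailBase i (a + s) ≤ tailBase i a * (1 + 1 / 2 ^ i) := by
    have := mul_le_tailBase hi (a := a) (c := 3 * s) ha (by linarith)
    have h3 : s * (2 * (1 + a) + s) ≤ tailBase i a := by nlinarith
    have e : tailBase i (a + s) = tailBase i a + s * (2 * (1 + a) + s) / 2 ^ i := by
      unfold tailBase; ring
    rw [e, mul_one_add (tailBase i a), mul_one_div]
    gcongr
  have hexp : (1 + 1 / (2 : ℝ) ^ i) ^ (2 ^ i - 1) ≤ 3 := by
    calc (1 + 1 / (2 : ℝ) ^ i) ^ (2 ^ i - 1) ≤ (1 + 1 / (2 : ℝ) ^ i) ^ (2 ^ i) :=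
          pow_le_pow_right₀ (by simp) (Nat.sub_le _ _)
      _ ≤ Real.exp (1 / 2 ^ i) ^ (2 ^ i) := by
          gcongr
          rw [add_comm]; exact Real.add_one_le_exp _
      _ = Real.exp 1 := by
          rw [← Real.exp_nat_mul]
          congr 1
          push_cast
          field_simp
      _ ≤ 3 := by linarith [Real.exp_one_lt_d9]
  have key := Convex.norm_image_sub_le_of_norm_hasDerivWithin_le (s := Set.Icc 0 (a + s))
    (f := radialLogDensity i) (x := a) (y := b)
    (C := 30 * ((1 + a) * tailBase i a ^ (2 ^ i - 1)))
    (fun x hx => (hasDerivAt_radialLogDensity i hx.1).hasDerivWithinAt)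
    (fun x hx => ?_) (convex_Icc _ _) ⟨ha, by linarith⟩
    ⟨hb, by linarith [le_abs_self (b - a)]⟩
  · rw [mul_comm]
    simpa using key
  · refine (abs_deriv_radialLogDensity_le i hx.1).trans ?_
    have hx1 := one_le_tailBase i hx.1
    have hmono : tailBase i x ≤ tailBase i (a + s) := by
      obtain ⟨h1, h2⟩ := hx
      unfold tailBase
      gcongr
    calc 5 * ((1 + x) * tailBase i x ^ (2 ^ i - 1))
        ≤ 5 * ((2 * (1 + a)) * (tailBase i a * (1 + 1 / 2 ^ i)) ^ (2 ^ i - 1)) := by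
          gcongr
          · linarith [hx.2]
          · exact hmono.trans hbase
      _ = 10 * ((1 + a) * tailBase i a ^ (2 ^ i - 1)) * (1 + 1 / 2 ^ i) ^ (2 ^ i - 1) := by
          rw [mul_pow]; ring
      _ ≤ 10 * ((1 + a) * tailBase i a ^ (2 ^ i - 1)) * 3 := by gcongr
      _ = _ := by ring

/-- The privacy loss of the light-tailed noise at `x`, for the shift `v`. -/
def loss (i : ℕ) (v x : ℝ) : ℝ := logDensity i x - logDensity i (x - v)

lemma measurable_loss (i : ℕ) (v : ℝ) : Measurable (loss i v) := by
  have := measurable_logDensity i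
  unfold loss
  fun_prop

lemma loss_sq_mul_exp_le {i : ℕ} (hi : 1 ≤ i) {l s v : ℝ} (hl : 1 ≤ l) (hv : |v| ≤ s)
    (hs : l * s * Real.sqrt (2 ^ i) ≤ 1 / 240) (x : ℝ) :
    loss i v x ^ 2 * Real.exp (l * |loss i v x|) ≤
      345600 * s ^ 2 * Real.exp (tail i |x| / 2) := by
  have hs0 : 0 ≤ s := (abs_nonneg _).trans hv
  have hr0 := Real.sqrt_nonneg ((2 : ℝ) ^ i)
  have hsl : s ≤ l * s := by nlinarith
  have ha := abs_nonneg x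
  set a := |x|
  have hv' : |(|x - v| - a)| ≤ |v| := by
    have := abs_abs_sub_abs_le_abs_sub (x - v) x
    rwa [sub_sub_cancel_left, abs_neg] at this
  have hloss : |loss i v x| ≤ s * (30 * ((1 + a) * tailBase i a ^ (2 ^ i - 1))) := by
    rw [loss, abs_sub_comm]
    refine (abs_radialLogDensity_sub_le hi ha (abs_nonneg (x - v)) (hv'.trans hv) ?_).trans ?_
    · have := mul_le_mul_of_nonneg_right hsl hr0
      linarith
    · have := one_le_tailBase i ha
      gcongr
      exact hv'.trans hv
  have hQ := one_le_tailBase i ha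
  have hpow : tailBase i a * tailBase i a ^ (2 ^ i - 1) = tail i a := by
    rw [tail, ← pow_succ', Nat.sub_add_cancel (Nat.one_le_two_pow)]
  have hT := one_le_tail i ha
  have hF : tailBase i a ^ (2 ^ i - 1) ≤ tail i a := by
    rw [← hpow]; exact le_mul_of_one_le_left (by positivity) hQ
  -- `240 * l * s * (1 + a) ≤ tailBase` completes the power to `tail`; the fraction is `30 / 240`.
  have h1 : l * |loss i v x| ≤ tail i a / 8 := by
    have hb := mul_le_tailBase hi (c := 240 * (l * s)) ha (by linarith)
    have hP : 0 ≤ tailBase i a ^ (2 ^ i - 1) := by positivity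
    have := mul_le_mul_of_nonneg_right hb hP
    rw [hpow] at this
    have := mul_le_mul_of_nonneg_left hloss (by linarith : 0 ≤ l)
    linarith
  have h2 : loss i v x ^ 2 ≤ 900 * s ^ 2 * tail i a ^ 3 := by
    calc loss i v x ^ 2 = |loss i v x| ^ 2 := (sq_abs _).symm
      _ ≤ (s * (30 * ((1 + a) * tailBase i a ^ (2 ^ i - 1)))) ^ 2 := by gcongr
      _ = 900 * s ^ 2 * ((1 + a) ^ 2 * (tailBase i a ^ (2 ^ i - 1)) ^ 2) := by ring
      _ ≤ 900 * s ^ 2 * (tail i a * tail i a ^ 2) := by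
          gcongr
          exact sq_one_add_le_tail i ha
      _ = _ := by ring
  -- `y ^ 3 / 3! ≤ exp y` at `y = tail i a / 4`, so `384 = 6 * 4 ^ 3`.
  have h3 : tail i a ^ 3 ≤ 384 * Real.exp (tail i a / 4) := by
    have := Real.pow_div_factorial_le_exp (tail i a / 4) (by linarith) 3
    norm_num [Nat.factorial] at this
    ring_nf at this ⊢
    linarith
  calc loss i v x ^ 2 * Real.exp (l * |loss i v x|)
      ≤ (900 * s ^ 2 * (384 * Real.exp (tail i a / 4))) * Real.exp (tail i a / 8) := by
        gcongr
        exact h2.trans (by gcongr)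
    _ = 345600 * s ^ 2 * Real.exp (tail i a / 4 + tail i a / 8) := by rw [Real.exp_add]; ring
    _ ≤ _ := by
        gcongr
        linarith

/-! ### Exponential moments of the privacy loss -/

lemma exp_le_one_add_add_sq_mul_exp (y : ℝ) : Real.exp y ≤ 1 + y + y ^ 2 * Real.exp |y| := by
  have h := Complex.norm_exp_sub_sum_le_norm_mul_exp (y : ℂ) 2
  have e : Complex.exp y - ∑ m ∈ Finset.range 2, (y : ℂ) ^ m / (m.factorial : ℂ) =
      ((Real.exp y - (1 + y) : ℝ) : ℂ) := by simp [Finset.sum_range_succ]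
  rw [e, Complex.norm_real, Complex.norm_real, Real.norm_eq_abs, Real.norm_eq_abs, sq_abs] at h
  linarith [le_abs_self (Real.exp y - (1 + y))]

/-- The combination is chosen so that the linear terms `l * y` and `-l * y` cancel. Since `exp
(-loss)` has mean one, no separate estimate of the mean of the loss is needed. -/
lemma exp_mul_add_mul_exp_neg_le {l : ℝ} (hl : 1 ≤ l) (y : ℝ) :
    Real.exp (l * y) + l * Real.exp (-y) ≤ 1 + l + 2 * l ^ 2 * (y ^ 2 * Real.exp (l * |y|)) := by
  have h1 := exp_le_one_add_add_sq_mul_exp (l * y)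
  have h2 := exp_le_one_add_add_sq_mul_exp (-y)
  rw [abs_mul, abs_of_nonneg (by linarith : 0 ≤ l)] at h1
  rw [abs_neg, neg_sq] at h2
  have h3 : Real.exp |y| ≤ Real.exp (l * |y|) :=
    Real.exp_le_exp.2 (le_mul_of_one_le_left (abs_nonneg y) hl)
  have h4 : l * (y ^ 2 * Real.exp |y|) ≤ l ^ 2 * (y ^ 2 * Real.exp (l * |y|)) := by
    gcongr
    nlinarith
  nlinarith [mul_le_mul_of_nonneg_left h2 (by linarith : 0 ≤ l)]

lemma lintegral_inv_sqrt :
    ∫⁻ u in Set.Ioo (0 : ℝ) 1, ENNReal.ofReal (u ^ (-(1 / 2) : ℝ)) = 2 := by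
  have hint : IntervalIntegrable (fun x : ℝ => x ^ (-(1 / 2) : ℝ)) volume 0 1 :=
    intervalIntegral.intervalIntegrable_rpow' (by norm_num)
  rw [intervalIntegrable_iff_integrableOn_Ioo_of_le zero_le_one] at hint
  rw [← ofReal_integral_eq_lintegral_ofReal hint, ← integral_Ioc_eq_integral_Ioo,
    ← intervalIntegral.integral_of_le zero_le_one, integral_rpow (Or.inl (by norm_num))]
  · norm_num
  · filter_upwards [ae_restrict_mem measurableSet_Ioo] with u hu
    exact Real.rpow_nonneg hu.1.le _

lemma lintegral_inv_sqrt_one_sub :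
    ∫⁻ u in Set.Ioo (0 : ℝ) 1, ENNReal.ofReal ((1 - u) ^ (-(1 / 2) : ℝ)) = 2 := by
  rw [← lintegral_inv_sqrt, ← lintegral_indicator measurableSet_Ioo,
    ← lintegral_indicator measurableSet_Ioo, ← lintegral_sub_left_eq_self _ (1 : ℝ)]
  congr 1
  ext u
  simp only [Set.indicator_apply, Set.mem_Ioo, sub_sub_cancel]
  congr 1
  exact propext ⟨fun h => ⟨by linarith, by linarith⟩, fun h => ⟨by linarith, by linarith⟩⟩

lemma tail_abs_quantile (i : ℕ) {u : ℝ} (hu : u ∈ Set.Ioo (0 : ℝ) 1) :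
    tail i |quantile i u| =
      if u ≤ 1 / 2 then 1 - Real.log (2 * u) else 1 - Real.log (2 - 2 * u) := by
  obtain ⟨h0, h1⟩ := hu
  unfold quantile
  split_ifs with h
  · have hl : 1 ≤ 1 - Real.log (2 * u) := by
      linarith [Real.log_nonpos (by linarith : 0 ≤ 2 * u) (by linarith)]
    rw [abs_neg, abs_of_nonneg (tailRoot_nonneg i hl), tail_tailRoot i hl]
  · have hl : 1 ≤ 1 - Real.log (2 - 2 * u) := by
      linarith [Real.log_nonpos (by linarith : 0 ≤ 2 - 2 * u) (by linarith)]
    rw [abs_of_nonneg (tailRoot_nonneg i hl), tail_tailRoot i hl]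

lemma exp_half_le {w : ℝ} (hw : 0 < w) :
    Real.exp ((1 - Real.log (2 * w)) / 2) ≤ 2 * w ^ (-(1 / 2) : ℝ) := by
  rw [Real.log_mul two_ne_zero hw.ne', Real.rpow_def_of_pos hw]
  calc Real.exp ((1 - (Real.log 2 + Real.log w)) / 2)
      = Real.exp ((1 - Real.log 2) / 2) * Real.exp (Real.log w * (-(1 / 2))) := by
        rw [← Real.exp_add]; ring_nf
    _ ≤ Real.exp (Real.log 2) * Real.exp (Real.log w * (-(1 / 2))) := by
        gcongr
        linarith [Real.log_two_gt_d9]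
    _ = _ := by rw [Real.exp_log two_pos]

/-- In terms of the uniform sample `u`, `exp (tail / 2)` is a multiple of `u ^ (-1/2)` or `(1 - u) ^
(-1/2)`. Bounding it by twice the sum of both gives `2 * 2 + 2 * 2 = 8`, independently of `i`. -/
lemma lintegral_exp_half_tail_le (i : ℕ) :
    ∫⁻ x, ENNReal.ofReal (Real.exp (tail i |x| / 2)) ∂(noiseLaw i) ≤ ENNReal.ofReal 8 := by
  have hm : Measurable fun x : ℝ => ENNReal.ofReal (Real.exp (tail i |x| / 2)) := by
    unfold tail tailBase; fun_prop
  rw [← map_quantile, lintegral_map hm (measurable_quantile i)]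
  calc _ ≤ ∫⁻ u in Set.Ioo (0 : ℝ) 1, (2 * ENNReal.ofReal (u ^ (-(1 / 2) : ℝ)) +
        2 * ENNReal.ofReal ((1 - u) ^ (-(1 / 2) : ℝ))) := by
        refine setLIntegral_mono (by fun_prop) fun u hu => ?_
        have h1 : (0 : ℝ) < 1 - u := by linarith [hu.2]
        have h2 : (2 : ENNReal) = ENNReal.ofReal 2 := by simp
        rw [h2, ← ENNReal.ofReal_mul zero_le_two, ← ENNReal.ofReal_mul zero_le_two,
          ← ENNReal.ofReal_add (by have := hu.1; positivity) (by positivity),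
          tail_abs_quantile i hu]
        apply ENNReal.ofReal_le_ofReal
        have p1 : 0 ≤ u ^ (-(1 / 2) : ℝ) := Real.rpow_nonneg hu.1.le _
        have p2 : 0 ≤ (1 - u) ^ (-(1 / 2) : ℝ) := Real.rpow_nonneg h1.le _
        split_ifs
        · linarith [exp_half_le hu.1]
        · have := exp_half_le h1
          rw [mul_one_sub] at this
          linarith
    _ = ENNReal.ofReal 8 := by
        rw [lintegral_add_left (by fun_prop), lintegral_const_mul _ (by fun_prop),
          lintegral_const_mul _ (by fun_prop), lintegral_inv_sqrt, lintegral_inv_sqrt_one_sub]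
        norm_num

/-- The integrand is the density ratio of the shifted to the original law, and the shifted law has
mass one. -/
lemma lintegral_exp_neg_loss (i : ℕ) (v : ℝ) :
    ∫⁻ x, ENNReal.ofReal (Real.exp (-loss i v x)) ∂(noiseLaw i) = 1 := by
  have hm := measurable_loss i v
  have hm' := measurable_logDensity i
  rw [noiseLaw, lintegral_withDensity_eq_lintegral_mul _ (by fun_prop) (by fun_prop)]
  have e : ∀ x, ENNReal.ofReal (Real.exp (logDensity i x)) *
      ENNReal.ofReal (Real.exp (-loss i v x)) =
      ENNReal.ofReal (Real.exp (logDensity i (x - v))) := fun x => by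
    rw [← ENNReal.ofReal_mul (Real.exp_pos _).le, ← Real.exp_add, loss]
    ring_nf
  simp only [Pi.mul_apply, e]
  rw [lintegral_sub_right_eq_self (fun x => ENNReal.ofReal (Real.exp (logDensity i x))) v]
  have : noiseLaw i Set.univ = 1 := measure_univ
  rwa [noiseLaw, withDensity_apply _ MeasurableSet.univ, setLIntegral_univ] at this

/-- The exponential moments of the privacy loss are those of a Gaussian. -/
theorem lintegral_exp_mul_loss_le {i : ℕ} (hi : 1 ≤ i) {l s v : ℝ} (hl : 1 ≤ l) (hv : |v| ≤ s)
    (hs : l * s * Real.sqrt (2 ^ i) ≤ 1 / 240) :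
    ∫⁻ x, ENNReal.ofReal (Real.exp (l * loss i v x)) ∂(noiseLaw i) ≤
      ENNReal.ofReal (Real.exp (5529600 * (l * s) ^ 2)) := by
  have hm := measurable_loss i v
  have hmt : Measurable fun x : ℝ => tail i |x| := by unfold tail tailBase; fun_prop
  have hl0 : 0 ≤ l := by linarith
  -- Adding `l = l * E exp (-loss)` to both sides keeps all integrands nonnegative, so no
  -- integrability of the loss is required. Here `5529600 = 8 * 2 * 345600`.
  have key : (∫⁻ x, ENNReal.ofReal (Real.exp (l * loss i v x)) ∂(noiseLaw i)) + ENNReal.ofReal l ≤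
      ENNReal.ofReal (1 + 5529600 * (l * s) ^ 2) + ENNReal.ofReal l := by
    calc _ = ∫⁻ x, (ENNReal.ofReal (Real.exp (l * loss i v x)) +
          ENNReal.ofReal l * ENNReal.ofReal (Real.exp (-loss i v x))) ∂(noiseLaw i) := by
          rw [lintegral_add_left (by fun_prop), lintegral_const_mul _ (by fun_prop),
            lintegral_exp_neg_loss, mul_one]
      _ ≤ ∫⁻ x, (ENNReal.ofReal (1 + l) + ENNReal.ofReal (691200 * (l * s) ^ 2) *
          ENNReal.ofReal (Real.exp (tail i |x| / 2))) ∂(noiseLaw i) := by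
          refine lintegral_mono fun x => ?_
          rw [← ENNReal.ofReal_mul hl0, ← ENNReal.ofReal_mul (by positivity),
            ← ENNReal.ofReal_add (by positivity) (by positivity),
            ← ENNReal.ofReal_add (by positivity) (by positivity)]
          apply ENNReal.ofReal_le_ofReal
          have h1 := exp_mul_add_mul_exp_neg_le hl (loss i v x)
          have h2 := mul_le_mul_of_nonneg_left (loss_sq_mul_exp_le hi hl hv hs x)
            (by positivity : 0 ≤ 2 * l ^ 2)
          linarith
      _ = ENNReal.ofReal (1 + l) + ENNReal.ofReal (691200 * (l * s) ^ 2) *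
          ∫⁻ x, ENNReal.ofReal (Real.exp (tail i |x| / 2)) ∂(noiseLaw i) := by
          rw [lintegral_add_left (by fun_prop), lintegral_const_mul _ (by fun_prop)]
          simp
      _ ≤ ENNReal.ofReal (1 + l) + ENNReal.ofReal (691200 * (l * s) ^ 2) * ENNReal.ofReal 8 := by
          gcongr
          exact lintegral_exp_half_tail_le i
      _ = _ := by
          rw [← ENNReal.ofReal_mul (by positivity), ← ENNReal.ofReal_add (by positivity)
            (by positivity), ← ENNReal.ofReal_add (by positivity) (by positivity)]
          ring_nf
  refine ((ENNReal.add_le_add_iff_right ENNReal.ofReal_ne_top).1 key).trans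
    (ENNReal.ofReal_le_ofReal ?_)
  rw [add_comm]
  exact Real.add_one_le_exp _

/-! ### Privacy of independent light-tailed noise -/

lemma map_add_noiseLaw (i : ℕ) (v : ℝ) : (noiseLaw i).map (· + v) =
    (noiseLaw i).withDensity fun x => ENNReal.ofReal (Real.exp (-loss i v x)) := by
  have hm := measurable_loss i v
  have hm' := measurable_logDensity i
  ext S hS
  have hS' : MeasurableSet ((· + v) ⁻¹' S) := hS.preimage (measurable_add_const v)
  rw [Measure.map_apply (measurable_add_const v) hS, noiseLaw, ← withDensity_mul _ (by fun_prop)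
    (by fun_prop), withDensity_apply _ hS', withDensity_apply _ hS, ← lintegral_indicator hS,
    ← lintegral_indicator hS']
  symm
  rw [← lintegral_add_right_eq_self _ v]
  refine lintegral_congr fun x => ?_
  by_cases hx : x + v ∈ S
  · rw [Set.indicator_of_mem hx, Set.indicator_of_mem (s := (· + v) ⁻¹' S) hx, Pi.mul_apply,
      ← ENNReal.ofReal_mul (Real.exp_pos _).le, ← Real.exp_add, loss]
    ring_nf
  · rw [Set.indicator_of_notMem hx, Set.indicator_of_notMem (s := (· + v) ⁻¹' S) hx]

lemma lintegral_prod_pi {d : ℕ} (μ : Measure ℝ) [IsProbabilityMeasure μ]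
    (f : Fin d → ℝ → ENNReal) (hf : ∀ j, Measurable (f j)) :
    ∫⁻ x, ∏ j, f j (x j) ∂(Measure.pi fun _ : Fin d => μ) = ∏ j, ∫⁻ x, f j x ∂μ := by
  rw [lintegral_prod_eq_prod_lintegral_of_indepFun Finset.univ
    (fun j (x : Fin d → ℝ) => f j (x j)) (iIndepFun_pi fun j => (hf j).aemeasurable)
    fun j => (hf j).comp (measurable_pi_apply j)]
  refine Finset.prod_congr rfl fun j _ => ?_
  rw [← lintegral_map (hf j) (measurable_pi_apply j), (measurePreserving_eval _ j).map_eq]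

lemma map_add_pi_noiseLaw {d : ℕ} (i : ℕ) (v : Fin d → ℝ) :
    (Measure.pi fun _ : Fin d => noiseLaw i).map (· + v) =
      (Measure.pi fun _ : Fin d => noiseLaw i).withDensity
        fun x => ∏ j, ENNReal.ofReal (Real.exp (-loss i (v j) (x j))) := by
  have hm := fun j => measurable_loss i (v j)
  have h1 : (Measure.pi fun _ : Fin d => noiseLaw i).map (· + v) =
      Measure.pi fun j => (noiseLaw i).map (· + v j) := by
    have : ∀ j, IsProbabilityMeasure ((noiseLaw i).map (· + v j)) := fun j =>
      Measure.isProbabilityMeasure_map (by fun_prop)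
    exact Measure.pi_map_pi (f := fun j x => x + v j) fun j => by fun_prop
  have : ∀ j, IsProbabilityMeasure ((noiseLaw i).map (· + v j)) := fun j =>
      Measure.isProbabilityMeasure_map (by fun_prop)
  rw [h1]
  refine Measure.pi_eq fun S hS => ?_
  rw [withDensity_apply _ (MeasurableSet.univ_pi hS), ← lintegral_indicator
    (MeasurableSet.univ_pi hS)]
  have e : ∀ x : Fin d → ℝ, (Set.univ.pi S).indicator
      (fun x => ∏ j, ENNReal.ofReal (Real.exp (-loss i (v j) (x j)))) x =
      ∏ j, (S j).indicator (fun y => ENNReal.ofReal (Real.exp (-loss i (v j) y))) (x j) := by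
    intro x
    by_cases hx : x ∈ Set.univ.pi S
    · rw [Set.indicator_of_mem hx]
      exact Finset.prod_congr rfl fun j _ => by rw [Set.indicator_of_mem (hx j trivial)]
    · rw [Set.indicator_of_notMem hx]
      simp only [Set.mem_pi, Set.mem_univ, true_imp_iff, not_forall] at hx
      obtain ⟨j, hj⟩ := hx
      exact (Finset.prod_eq_zero (Finset.mem_univ j) (Set.indicator_of_notMem hj _)).symm
  simp only [e]
  rw [lintegral_prod_pi _ _ fun j => Measurable.indicator (by fun_prop) (hS j)]
  refine Finset.prod_congr rfl fun j _ => ?_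
  rw [map_add_noiseLaw, withDensity_apply _ (hS j), lintegral_indicator (hS j)]

/-- Where the total loss is at most `ε`, the density ratio is at most `exp ε`. The rest has small
mass by Markov's inequality for the `l`-th exponential moment, which factors over the coordinates.
-/
theorem pi_noiseLaw_le {d i : ℕ} (hi : 1 ≤ i) {l s ε : ℝ} (hl : 1 ≤ l)
    (hs : l * s * Real.sqrt (2 ^ i) ≤ 1 / 240) (v : Fin d → ℝ) (hv : ∀ j, |v j| ≤ s)
    {A : Set (Fin d → ℝ)} (hA : MeasurableSet A) :
    (Measure.pi fun _ : Fin d => noiseLaw i) A ≤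
      ENNReal.ofReal (Real.exp ε) *
        (Measure.pi fun _ : Fin d => noiseLaw i) ((· + v) ⁻¹' A) +
      ENNReal.ofReal (Real.exp (d * (5529600 * (l * s) ^ 2) - l * ε)) := by
  have hm := fun j => measurable_loss i (v j)
  set μ := Measure.pi fun _ : Fin d => noiseLaw i
  set Λ : (Fin d → ℝ) → ℝ := fun x => ∑ j, loss i (v j) (x j)
  have hΛ : Measurable Λ := by fun_prop
  have hG : MeasurableSet {x | Λ x ≤ ε} := measurableSet_le hΛ measurable_const
  have hgood : μ (A ∩ {x | Λ x ≤ ε}) ≤ ENNReal.ofReal (Real.exp ε) * μ ((· + v) ⁻¹' A) := by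
    rw [← Measure.map_apply (by fun_prop) hA, map_add_pi_noiseLaw, withDensity_apply _ hA,
      ← lintegral_const_mul _ (by fun_prop)]
    calc μ (A ∩ {x | Λ x ≤ ε}) = ∫⁻ x in A ∩ {x | Λ x ≤ ε}, 1 ∂μ := setLIntegral_one _ |>.symm
      _ ≤ ∫⁻ x in A ∩ {x | Λ x ≤ ε}, ENNReal.ofReal (Real.exp ε) *
          ∏ j, ENNReal.ofReal (Real.exp (-loss i (v j) (x j))) ∂μ := by
          refine setLIntegral_mono (by fun_prop) fun x hx => ?_
          rw [← ENNReal.ofReal_prod_of_nonneg fun j _ => (Real.exp_pos _).le, ← Real.exp_sum,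
            ← ENNReal.ofReal_mul (Real.exp_pos _).le, ← Real.exp_add, Finset.sum_neg_distrib]
          refine ENNReal.one_le_ofReal.2 (Real.one_le_exp ?_)
          have := hx.2
          simp only [Set.mem_ofPred_eq, Λ] at this
          linarith
      _ ≤ _ := lintegral_mono_set Set.inter_subset_left
  have hbad : μ {x | Λ x ≤ ε}ᶜ ≤
      ENNReal.ofReal (Real.exp (d * (5529600 * (l * s) ^ 2) - l * ε)) := by
    calc μ {x | Λ x ≤ ε}ᶜ = ∫⁻ x in {x | Λ x ≤ ε}ᶜ, 1 ∂μ := setLIntegral_one _ |>.symm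
      _ ≤ ∫⁻ x in {x | Λ x ≤ ε}ᶜ, ENNReal.ofReal (Real.exp (-(l * ε))) *
          ∏ j, ENNReal.ofReal (Real.exp (l * loss i (v j) (x j))) ∂μ := by
          refine setLIntegral_mono (by fun_prop) fun x hx => ?_
          rw [← ENNReal.ofReal_prod_of_nonneg fun j _ => (Real.exp_pos _).le, ← Real.exp_sum,
            ← ENNReal.ofReal_mul (Real.exp_pos _).le, ← Real.exp_add, ← Finset.mul_sum]
          refine ENNReal.one_le_ofReal.2 (Real.one_le_exp ?_)
          have hx' : ε < Λ x := not_le.1 hx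
          simp only [Λ] at hx'
          nlinarith
      _ ≤ ∫⁻ x, ENNReal.ofReal (Real.exp (-(l * ε))) *
          ∏ j, ENNReal.ofReal (Real.exp (l * loss i (v j) (x j))) ∂μ :=
          setLIntegral_le_lintegral _ _
      _ = ENNReal.ofReal (Real.exp (-(l * ε))) *
          ∏ j, ∫⁻ x, ENNReal.ofReal (Real.exp (l * loss i (v j) x)) ∂(noiseLaw i) := by
          rw [lintegral_const_mul _ (by fun_prop), lintegral_prod_pi _
            (fun j x => ENNReal.ofReal (Real.exp (l * loss i (v j) x))) (by fun_prop)]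
      _ ≤ ENNReal.ofReal (Real.exp (-(l * ε))) *
          ∏ j : Fin d, ENNReal.ofReal (Real.exp (5529600 * (l * s) ^ 2)) := by
          gcongr with j
          exact lintegral_exp_mul_loss_le hi hl (hv j) hs
      _ = _ := by
          rw [← ENNReal.ofReal_prod_of_nonneg fun j _ => (Real.exp_pos _).le, ← Real.exp_sum,
            ← ENNReal.ofReal_mul (Real.exp_pos _).le, ← Real.exp_add]
          simp only [Finset.sum_const, Finset.card_univ, Fintype.card_fin, nsmul_eq_mul]
          ring_nf
  calc μ A ≤ μ (A ∩ {x | Λ x ≤ ε}) + μ {x | Λ x ≤ ε}ᶜ :=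
        (measure_mono fun x hx => (em (Λ x ≤ ε)).imp (fun h => ⟨hx, h⟩) id).trans
          (measure_union_le _ _)
    _ ≤ _ := add_le_add hgood hbad

/-! ### Privacy of the scale mixture of uniform distributions on the cube -/

lemma runningMax_congr {f g : ℕ → ℝ} {k : ℕ} (h : ∀ i < k, f i = g i) :
    runningMax f k = runningMax g k := by
  induction k with
  | zero => rfl
  | succ k ih =>
    rw [runningMax, runningMax, ih fun i hi => h i (hi.trans k.lt_succ_self), h k k.lt_succ_self]

lemma runningMax_const_mul {c : ℝ} (hc : 0 ≤ c) (f : ℕ → ℝ) (k : ℕ) :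
    runningMax (fun i => c * f i) k = c * runningMax f k := by
  induction k with
  | zero => simp [runningMax]
  | succ k ih => rw [runningMax, runningMax, ih, mul_max_of_nonneg _ _ hc]

lemma le_runningMax (f : ℕ → ℝ) {i k : ℕ} (h : i < k) : f i ≤ runningMax f k := by
  induction k with
  | zero => omega
  | succ k ih =>
    rcases Nat.lt_succ_iff_lt_or_eq.1 h with h | rfl
    · exact (ih h).trans (le_max_left _ _)
    · exact le_max_right _ _

lemma runningMax_le {f : ℕ → ℝ} {k : ℕ} {c : ℝ} (hc : 0 ≤ c) (h : ∀ i < k, f i ≤ c) :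
    runningMax f k ≤ c := by
  induction k with
  | zero => exact hc
  | succ k ih => exact max_le (ih fun i hi => h i (hi.trans k.lt_succ_self)) (h k k.lt_succ_self)

/-- The maximum of `0` and the entries of a vector. -/
def vecMax {d : ℕ} (U : Fin d → ℝ) : ℝ := runningMax (fun i => if h : i < d then U ⟨i, h⟩ else 0) d

lemma measurable_vecMax {d : ℕ} : Measurable (vecMax (d := d)) := by
  have : ∀ k, Measurable fun U : Fin d → ℝ =>
      runningMax (fun i => if h : i < d then U ⟨i, h⟩ else 0) k := by
    intro k
    induction k with
    | zero => exact measurable_const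
    | succ k ih =>
      refine ih.max ?_
      by_cases h : k < d
      · simpa only [h, dite_true] using measurable_pi_apply (⟨k, h⟩ : Fin d)
      · simpa only [h, dite_false] using measurable_const
  exact this d

lemma vecMax_smul {d : ℕ} {c : ℝ} (hc : 0 ≤ c) (U : Fin d → ℝ) : vecMax (c • U) = c * vecMax U := by
  rw [vecMax, vecMax, ← runningMax_const_mul hc]
  refine runningMax_congr fun i hi => ?_
  simp [hi]

lemma le_vecMax {d : ℕ} (U : Fin d → ℝ) (j : Fin d) : U j ≤ vecMax U := by
  have := le_runningMax (fun i => if h : i < d then U ⟨i, h⟩ else 0) j.2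
  simpa [vecMax] using this

lemma vecMax_le {d : ℕ} {U : Fin d → ℝ} {c : ℝ} (hc : 0 ≤ c) (h : ∀ j, U j ≤ c) :
    vecMax U ≤ c := by
  refine runningMax_le hc fun i hi => ?_
  simpa [hi] using h ⟨i, hi⟩

/-- The open unit box. -/
def unitBox (d : ℕ) : Set (Fin d → ℝ) := Set.univ.pi fun _ => Set.Ioo 0 1

lemma measurableSet_unitBox (d : ℕ) : MeasurableSet (unitBox d) :=
  MeasurableSet.univ_pi fun _ => measurableSet_Ioo

lemma mem_unitBox {d : ℕ} {x : Fin d → ℝ} : x ∈ unitBox d ↔ ∀ j, 0 < x j ∧ x j < 1 := by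
  simp [unitBox]

/-- A point of the cube `[-1, 1]^d`, given by `V`, scaled by `r` and divided by `vecMax U`. -/
def cubePoint {d : ℕ} (r : ℝ) (U V : Fin d → ℝ) : Fin d → ℝ :=
  fun j => r * (2 * V j - 1) / vecMax U

lemma measurable_cubePoint {d : ℕ} (r : ℝ) :
    Measurable fun x : (Fin d → ℝ) × (Fin d → ℝ) => cubePoint r x.1 x.2 := by
  have := measurable_vecMax (d := d)
  unfold cubePoint
  refine measurable_pi_lambda _ fun j => ?_
  fun_prop

section

variable {d : ℕ} {r s : ℝ} {a a' : Fin d → ℝ} {A : Set (Fin d → ℝ)}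

/-- Replacing `U` by `θ⁻¹ • U` enlarges the cube by `θ`, and then the cube around `a` fits into the
enlarged one around `a'`. In the coordinate `V` the inclusion is an affine contraction by `θ⁻¹`,
whose Jacobian accounts for `θ ^ d`. -/
lemma volume_cubePoint_le (hd : 0 < d) (hr : 0 < r) (hs : ∀ j, |a j - a' j| ≤ s)
    {U : Fin d → ℝ} (hU : U ∈ unitBox d) :
    volume ({V | a + cubePoint r U V ∈ A} ∩ unitBox d) ≤
      ENNReal.ofReal ((1 + s / r) ^ d) *
        volume ({V | a' + cubePoint r ((1 + s / r)⁻¹ • U) V ∈ A} ∩ unitBox d) := by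
  have hs0 : 0 ≤ s := (abs_nonneg _).trans (hs ⟨0, hd⟩)
  set θ := 1 + s / r with hθ
  have hθ0 : 0 < θ := by positivity
  have hU' := mem_unitBox.1 hU
  have hW0 : 0 < vecMax U := (hU' ⟨0, hd⟩).1.trans_le (le_vecMax U _)
  have hW1 : vecMax U ≤ 1 := vecMax_le zero_le_one fun j => (hU' j).2.le
  have hWθ : vecMax (θ⁻¹ • U) = θ⁻¹ * vecMax U := vecMax_smul (by positivity) U
  -- Solves `a' + cubePoint r (θ⁻¹ • U) (θ⁻¹ • V + c) = a + cubePoint r U V`. That the image stays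
  -- in the unit box uses `vecMax U ≤ 1`.
  set c : Fin d → ℝ := fun j => 1 / 2 - θ⁻¹ / 2 + (a j - a' j) * vecMax U * θ⁻¹ / (2 * r)
  have hsub : {V | a + cubePoint r U V ∈ A} ∩ unitBox d ⊆
      (fun V => θ⁻¹ • V) ⁻¹' ((· + c) ⁻¹'
        ({V | a' + cubePoint r (θ⁻¹ • U) V ∈ A} ∩ unitBox d)) := by
    rintro V ⟨hV, hV'⟩
    refine ⟨?_, mem_unitBox.2 fun j => ?_⟩
    · have : a' + cubePoint r (θ⁻¹ • U) (θ⁻¹ • V + c) = a + cubePoint r U V := by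
        ext j
        simp only [Pi.add_apply, cubePoint, hWθ, Pi.smul_apply, smul_eq_mul, c]
        field_simp
        ring
      simpa [this] using hV
    · have hj := mem_unitBox.1 hV' j
      have h1 : |(a j - a' j) * vecMax U| ≤ s := by
        rw [abs_mul, abs_of_pos hW0]
        nlinarith [hs j, abs_nonneg (a j - a' j)]
      obtain ⟨h2, h3⟩ := abs_le.1 h1
      have hθr : θ * r = r + s := by rw [hθ]; field_simp
      have e : (θ⁻¹ • V + c) j =
          (2 * r * V j + (θ * r) - r + (a j - a' j) * vecMax U) / (2 * (θ * r)) := by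
        simp only [Pi.add_apply, Pi.smul_apply, smul_eq_mul, c]
        field_simp
        ring
      change 0 < (θ⁻¹ • V + c) j ∧ (θ⁻¹ • V + c) j < 1
      rw [e, hθr]
      have hrs : 0 < 2 * (r + s) := by positivity
      have h4 : 0 < r * V j := mul_pos hr hj.1
      have h5 : r * V j < r := by nlinarith [hj.2]
      exact ⟨div_pos (by linarith) hrs, (div_lt_one hrs).2 (by linarith)⟩
  refine (measure_mono hsub).trans ?_
  rw [Measure.addHaar_preimage_smul _ (inv_ne_zero hθ0.ne'), measure_preimage_add_right]
  simp [abs_of_pos hθ0]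

/-- One factor `θ ^ d` comes from `V`, for fixed `U`; the other is the Jacobian of the substitution
`U ↦ θ⁻¹ • U`, which maps the unit box into itself. -/
theorem unitBox_prod_cubePoint_le (hd : 0 < d) (hr : 0 < r) (hs : ∀ j, |a j - a' j| ≤ s)
    (hA : MeasurableSet A) :
    ((volume.restrict (unitBox d)).prod (volume.restrict (unitBox d)))
        {x | a + cubePoint r x.1 x.2 ∈ A} ≤
      ENNReal.ofReal ((1 + s / r) ^ (2 * d)) *
        ((volume.restrict (unitBox d)).prod (volume.restrict (unitBox d)))
          {x | a' + cubePoint r x.1 x.2 ∈ A} := by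
  have hs0 : 0 ≤ s := (abs_nonneg _).trans (hs ⟨0, hd⟩)
  have hm := measurable_cubePoint (d := d) r
  have hS : ∀ b : Fin d → ℝ, MeasurableSet
      {x : (Fin d → ℝ) × (Fin d → ℝ) | b + cubePoint r x.1 x.2 ∈ A} :=
    fun b => hA.preimage (hm.const_add b)
  have hb := measurableSet_unitBox d
  set θ := 1 + s / r with hθ
  have hθ1 : 1 ≤ θ := by rw [hθ, le_add_iff_nonneg_right]; positivity
  have hθ0 : 0 < θ := by linarith
  rw [Measure.prod_apply (hS a), Measure.prod_apply (hS a')]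
  set h : (Fin d → ℝ) → ENNReal := fun U => volume.restrict (unitBox d)
    (Prod.mk U ⁻¹' {x | a' + cubePoint r x.1 x.2 ∈ A}) with hh
  have hhm : Measurable h := measurable_measure_prodMk_left (hS a')
  have happ : ∀ (b U : Fin d → ℝ), volume.restrict (unitBox d)
      (Prod.mk U ⁻¹' {x | b + cubePoint r x.1 x.2 ∈ A}) =
      volume ({V | b + cubePoint r U V ∈ A} ∩ unitBox d) := fun b U =>
    Measure.restrict_apply' hb
  calc _ ≤ ∫⁻ U in unitBox d, ENNReal.ofReal (θ ^ d) * (unitBox d).indicator h (θ⁻¹ • U) := by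
        refine setLIntegral_mono (by
          have := hhm.indicator hb
          fun_prop) fun U hU => ?_
        have hU' : θ⁻¹ • U ∈ unitBox d := mem_unitBox.2 fun j => by
          have := mem_unitBox.1 hU j
          have h1 : 0 < θ⁻¹ := by positivity
          have h2 : θ⁻¹ ≤ 1 := inv_le_one_of_one_le₀ hθ1
          simp only [Pi.smul_apply, smul_eq_mul]
          exact ⟨mul_pos h1 this.1, by nlinarith⟩
        rw [Set.indicator_of_mem hU', hh]
        simp only [happ]
        exact volume_cubePoint_le hd hr hs hU
    _ ≤ ∫⁻ U, ENNReal.ofReal (θ ^ d) * (unitBox d).indicator h (θ⁻¹ • U) :=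
        setLIntegral_le_lintegral _ _
    _ = ENNReal.ofReal (θ ^ d) * ∫⁻ U, (unitBox d).indicator h U
          ∂(volume.map fun U : Fin d → ℝ => θ⁻¹ • U) := by
        rw [lintegral_const_mul _ (by
          have := hhm.indicator hb
          fun_prop), lintegral_map (hhm.indicator hb) (by fun_prop)]
    _ = ENNReal.ofReal (θ ^ (2 * d)) * ∫⁻ U in unitBox d, h U := by
        rw [Measure.map_addHaar_smul _ (inv_ne_zero hθ0.ne'), lintegral_smul_measure,
          lintegral_indicator hb, two_mul, pow_add, ENNReal.ofReal_mul (by positivity), mul_assoc]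
        simp [abs_of_pos hθ0]

end

/-! ### The joint law of the random draws -/

instance : IsProbabilityMeasure randomnessLaw := by unfold randomnessLaw; infer_instance

lemma map_coe_unitInterval :
    (volume : Measure unitInterval).map Subtype.val = volume.restrict (Set.Ioo (0 : ℝ) 1) := by
  rw [unitInterval.measurePreserving_coe.map_eq]
  exact Measure.restrict_congr_set Ioo_ae_eq_Icc.symm

lemma map_uniforms {ι : Type*} [Fintype ι] {e : ι → ℕ} (he : Function.Injective e) :
    randomnessLaw.map (fun ω i => (ω.1 (e i) : ℝ)) =
      Measure.pi fun _ : ι => volume.restrict (Set.Ioo (0 : ℝ) 1) := by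
  set μ := Measure.infinitePi fun _ : ℕ => (volume : Measure unitInterval)
  have h1 : randomnessLaw.map (fun ω i => (ω.1 (e i) : ℝ)) =
      μ.map (fun x i => (x (e i) : ℝ)) := by
    rw [← (measurePreserving_fst (μ := μ)
      (ν := Measure.infinitePi fun _ : ℕ => gaussianReal 0 1)).map_eq,
      Measure.map_map (by fun_prop) (by fun_prop)]
    rfl
  have h2 : iIndepFun (fun i (x : ℕ → unitInterval) => (x (e i) : ℝ)) μ :=
    (iIndepFun_infinitePi (X := fun (_ : ℕ) (x : unitInterval) => (x : ℝ))
      fun _ => measurable_subtype_coe).precomp he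
  have h3 : ∀ i, Measurable fun x : ℕ → unitInterval => (x (e i) : ℝ) := fun i =>
    measurable_subtype_coe.comp (measurable_pi_apply (e i))
  rw [h1, (iIndepFun_iff_map_fun_eq_pi_map fun i => (h3 i).aemeasurable).1 h2]
  congr 1
  ext1 i
  rw [← map_coe_unitInterval, ← (measurePreserving_eval_infinitePi
    (fun _ : ℕ => (volume : Measure unitInterval)) (e i)).map_eq,
    Measure.map_map (by fun_prop) (by fun_prop)]
  rfl

lemma map_quantile_uniforms (i d : ℕ) :
    randomnessLaw.map (fun ω (j : Fin d) => quantile i (ω.1 j)) =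
      Measure.pi fun _ : Fin d => noiseLaw i := by
  have hq := measurable_quantile i
  have : SigmaFinite ((volume.restrict (Set.Ioo (0 : ℝ) 1)).map (quantile i)) := by
    rw [map_quantile]; infer_instance
  rw [← map_quantile, ← Measure.pi_map_pi fun _ => hq.aemeasurable,
    ← map_uniforms (e := fun j : Fin d => (j : ℕ)) Fin.val_injective,
    Measure.map_map (by fun_prop) (by fun_prop)]
  rfl

/-- The radius uses samples `d, …, 2 d - 1` and the direction samples `0, …, d - 1`; the index sets
are disjoint, hence the product law. -/
lemma map_uniforms_prod (d : ℕ) :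
    randomnessLaw.map (fun ω => ((fun i : Fin d => (ω.1 (i + d) : ℝ)),
      (fun j : Fin d => (ω.1 j : ℝ)))) =
      (volume.restrict (unitBox d)).prod (volume.restrict (unitBox d)) := by
  have he : Function.Injective (Sum.elim (fun i : Fin d => (i : ℕ) + d) (fun j : Fin d => (j : ℕ))) := by
    rintro (a | a) (b | b) h <;> simp only [Sum.elim_inl, Sum.elim_inr] at h
    · exact congrArg Sum.inl (Fin.ext (by omega))
    · omega
    · omega
    · exact congrArg Sum.inr (Fin.ext h)
  have h := measurePreserving_sumPiEquivProdPi
    (fun _ : Fin d ⊕ Fin d => volume.restrict (Set.Ioo (0 : ℝ) 1))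
  have hb : (Measure.pi fun _ : Fin d => volume.restrict (Set.Ioo (0 : ℝ) 1)) =
      volume.restrict (unitBox d) := by
    rw [unitBox, volume_pi, Measure.restrict_pi_pi]
  rw [← hb, ← h.map_eq, ← map_uniforms he, Measure.map_map (by fun_prop) (by fun_prop)]
  rfl

/-! ### The two noise vectors -/

lemma cubeNoise_eq_cubePoint (d : ℕ) (α : ℝ) (ω : Randomness) (j : Fin d) :
    cubeNoise d α ω j = cubePoint (α / 4) (fun i : Fin d => (ω.1 (i + d) : ℝ))
      (fun j : Fin d => (ω.1 j : ℝ)) j := by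
  rw [cubeNoise, cubePoint, vecMax]
  congr 1
  refine runningMax_congr fun i hi => ?_
  simp [hi]

lemma measurable_cubeNoise (d : ℕ) (α : ℝ) :
    Measurable fun ω (j : Fin d) => cubeNoise d α ω j := by
  simp only [cubeNoise_eq_cubePoint]
  exact (measurable_cubePoint (d := d) (α / 4)).comp
    (f := fun ω : Randomness => ((fun i : Fin d => (ω.1 (i + d) : ℝ)),
      (fun j : Fin d => (ω.1 j : ℝ)))) (by fun_prop)

lemma measurable_productNoise (d : ℕ) (α : ℝ) :
    Measurable fun ω (j : Fin d) => productNoise d α ω j := by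
  have := measurable_quantile (doublings (Real.log (Real.log d)) d)
  unfold productNoise
  fun_prop

lemma measurable_noise (d : ℕ) (δ α : ℝ) : Measurable fun ω (j : Fin d) => noise d δ α ω j := by
  unfold noise
  split_ifs
  · exact measurable_cubeNoise d α
  · exact measurable_productNoise d α

section

variable {d : ℕ} {α s : ℝ} {a a' : Fin d → ℝ} {A : Set (Fin d → ℝ)}

lemma cubeNoise_privacy (hd : 0 < d) (hα : 0 < α) (hs : ∀ j, |a j - a' j| ≤ s)
    (hA : MeasurableSet A) :
    randomnessLaw {ω | a + (fun j : Fin d => cubeNoise d α ω j) ∈ A} ≤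
      ENNReal.ofReal ((1 + s / (α / 4)) ^ (2 * d)) *
        randomnessLaw {ω | a' + (fun j : Fin d => cubeNoise d α ω j) ∈ A} := by
  have key : ∀ b : Fin d → ℝ,
      randomnessLaw {ω | b + (fun j : Fin d => cubeNoise d α ω j) ∈ A} =
      ((volume.restrict (unitBox d)).prod (volume.restrict (unitBox d)))
        {x | b + cubePoint (α / 4) x.1 x.2 ∈ A} := fun b => by
    have hS : MeasurableSet
        {x : (Fin d → ℝ) × (Fin d → ℝ) | b + cubePoint (α / 4) x.1 x.2 ∈ A} :=
      hA.preimage ((measurable_cubePoint (α / 4)).const_add b)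
    rw [← map_uniforms_prod, Measure.map_apply (by fun_prop) hS]
    congr 1
    ext ω
    simp only [cubeNoise_eq_cubePoint, Set.mem_preimage, Set.mem_ofPred_eq]
  rw [key, key]
  exact unitBox_prod_cubePoint_le hd (by linarith) hs hA

lemma productNoise_privacy {l ε : ℝ} (hα : 0 < α)
    (hi : 1 ≤ doublings (Real.log (Real.log d)) d) (hl : 1 ≤ l)
    (hs : l * s * Real.sqrt (2 ^ doublings (Real.log (Real.log d)) d) ≤ 1 / 240)
    (ha : ∀ j, |a j - a' j| ≤ s * (α / (4 * Real.sqrt (2 ^ doublings (Real.log (Real.log d)) d))))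
    (hA : MeasurableSet A) :
    randomnessLaw {ω | a + (fun j : Fin d => productNoise d α ω j) ∈ A} ≤
      ENNReal.ofReal (Real.exp ε) *
        randomnessLaw {ω | a' + (fun j : Fin d => productNoise d α ω j) ∈ A} +
      ENNReal.ofReal (Real.exp (d * (5529600 * (l * s) ^ 2) - l * ε)) := by
  set i := doublings (Real.log (Real.log d)) d with hidef
  set r : ℝ := α / (4 * Real.sqrt (2 ^ i)) with hr
  have hr0 : 0 < r := by positivity
  have key : ∀ b : Fin d → ℝ,
      randomnessLaw {ω | b + (fun j : Fin d => productNoise d α ω j) ∈ A} =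
      (Measure.pi fun _ : Fin d => noiseLaw i) {x | b + r • x ∈ A} := fun b => by
    have hS : MeasurableSet {x : Fin d → ℝ | b + r • x ∈ A} :=
      hA.preimage (f := fun x => b + r • x) (by fun_prop)
    rw [← map_quantile_uniforms, Measure.map_apply
      (by have := measurable_quantile i; fun_prop) hS]
    rfl
  -- In units of the noise scale `r`, passing from `a` to `a'` is a shift of the noise by this
  -- vector.
  have hv : ∀ j, |(r⁻¹ • (a' - a)) j| ≤ s := fun j => by
    simp only [Pi.smul_apply, Pi.sub_apply, smul_eq_mul]
    rw [abs_mul, abs_of_pos (by positivity), abs_sub_comm, inv_mul_le_iff₀ hr0, mul_comm r]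
    exact ha j
  have h := pi_noiseLaw_le (ε := ε) hi hl hs (r⁻¹ • (a' - a)) hv
    (A := {x | a + r • x ∈ A}) (hA.preimage (f := fun x => a + r • x) (by fun_prop))
  rw [key, key]
  convert h using 4
  ext x
  simp only [Set.mem_preimage, Set.mem_ofPred_eq]
  rw [smul_add, smul_inv_smul₀ hr0.ne']
  congr! 1
  abel

/-! ### Accuracy of the two noise vectors -/

lemma cubeNoise_utility (hα : 0 < α) :
    randomnessLaw {ω | ∃ j : Fin d, α ≤ |cubeNoise d α ω j|} ≤ ENNReal.ofReal (Real.exp (-d)) := by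
  have hinj : Function.Injective fun i : Fin d => (i : ℕ) + d :=
    fun i j h => Fin.ext (by simpa using h)
  calc randomnessLaw {ω | ∃ j : Fin d, α ≤ |cubeNoise d α ω j|}
      -- If some radius sample is at least `1 / 3`, the noise is at most `3 * α / 4`. Otherwise all
      -- `d` of them are below `1 / 3`, and `1 / 3 ≤ exp (-1)`.
      ≤ randomnessLaw ((fun ω (i : Fin d) => (ω.1 (i + d) : ℝ)) ⁻¹'
          Set.univ.pi fun _ => Set.Iio (1 / 3 : ℝ)) := by
        refine measure_mono fun ω hω => ?_
        obtain ⟨j, hj⟩ := hω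
        rw [cubeNoise_eq_cubePoint, cubePoint] at hj
        by_contra hcon
        simp only [Set.mem_preimage, Set.mem_pi, Set.mem_univ, true_imp_iff, Set.mem_Iio,
          not_forall, not_lt] at hcon
        obtain ⟨k, hk⟩ := hcon
        have hW := hk.trans (le_vecMax (fun i : Fin d => (ω.1 (i + d) : ℝ)) k)
        set W := vecMax (fun i : Fin d => (ω.1 (i + d) : ℝ))
        have hV0 := (ω.1 j).2.1
        have hV1 := (ω.1 j).2.2
        have hV : |2 * (ω.1 j : ℝ) - 1| ≤ 1 := abs_le.2 ⟨by linarith, by linarith⟩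
        have hW0 : 0 < W := by linarith
        rw [abs_div, abs_mul, abs_of_pos hW0, abs_of_pos (by positivity : 0 < α / 4),
          le_div_iff₀ hW0] at hj
        nlinarith
    _ = ENNReal.ofReal (1 / 3) ^ d := by
        rw [← Measure.map_apply (by fun_prop) (MeasurableSet.univ_pi fun _ => measurableSet_Iio),
          map_uniforms hinj, Measure.pi_pi]
        have : volume.restrict (Set.Ioo (0 : ℝ) 1) (Set.Iio (1 / 3)) = ENNReal.ofReal (1 / 3) := by
          rw [Measure.restrict_apply measurableSet_Iio, Set.Iio_inter_Ioo, Real.volume_Ioo]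
          norm_num
        simp only [this]
        simp
    _ ≤ ENNReal.ofReal (Real.exp (-1)) ^ d := by
        gcongr
        rw [Real.exp_neg, one_div]
        exact inv_anti₀ (Real.exp_pos 1) (by linarith [Real.exp_one_lt_d9])
    _ = _ := by
        rw [← ENNReal.ofReal_pow (Real.exp_pos _).le, ← Real.exp_nat_mul]
        ring_nf

/-- Already `z ^ 2 / 2 ^ i ≥ 16` puts the base of the power above `exp 2`. This makes the tail
doubly exponential in `q = 2 ^ i` at distance `4 * √q`. -/
lemma exp_le_tail {i : ℕ} {z : ℝ} (hz : 4 * Real.sqrt (2 ^ i) ≤ z) :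
    Real.exp (2 * 2 ^ i) ≤ tail i z := by
  have hr := Real.sq_sqrt (by positivity : (0 : ℝ) ≤ 2 ^ i)
  have hr0 := Real.sqrt_nonneg ((2 : ℝ) ^ i)
  have hb : Real.exp 2 ≤ tailBase i z := by
    have h1 : 16 ≤ (2 * z + z ^ 2) / 2 ^ i := by
      rw [le_div_iff₀ (by positivity)]
      nlinarith
    have h2 : Real.exp 2 ≤ 9 := by
      have := Real.exp_one_lt_d9
      have h := Real.exp_pos 1
      rw [show (2 : ℝ) = 1 + 1 by norm_num, Real.exp_add]
      nlinarith
    unfold tailBase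
    linarith
  calc Real.exp (2 * 2 ^ i) = Real.exp 2 ^ 2 ^ i := by
        rw [← Real.exp_nat_mul]; push_cast; ring_nf
    _ ≤ _ := by unfold tail; gcongr

lemma volume_quantile_le {i : ℕ} {b : ℝ} (hb : b ≤ Real.exp (2 * 2 ^ i)) :
    volume.restrict (Set.Ioo (0 : ℝ) 1) {u | 4 * Real.sqrt (2 ^ i) ≤ |quantile i u|} ≤
      ENNReal.ofReal (Real.exp (1 - b)) := by
  rw [Measure.restrict_apply' measurableSet_Ioo]
  set t := Real.exp (1 - b) / 2 with ht
  have ht0 : 0 < t := by positivity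
  calc _ ≤ volume (Set.Icc 0 t ∪ Set.Icc (1 - t) 1) := by
        refine measure_mono ?_
        rintro u ⟨h1, h2⟩
        have h3 := hb.trans (exp_le_tail h1)
        rw [tail_abs_quantile i h2] at h3
        have key : ∀ w : ℝ, 0 < w → b ≤ 1 - Real.log (2 * w) → w ≤ t := fun w hw h => by
          have := (Real.log_le_iff_le_exp (by positivity)).1
            (by linarith : Real.log (2 * w) ≤ 1 - b)
          linarith
        split_ifs at h3
        · exact Or.inl ⟨h2.1.le, key u h2.1 h3⟩
        · exact Or.inr ⟨by linarith [key (1 - u) (by linarith [h2.2]) (by rwa [mul_one_sub])],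
            h2.2.le⟩
    _ ≤ ENNReal.ofReal (t - 0) + ENNReal.ofReal (1 - (1 - t)) := by
        refine (measure_union_le _ _).trans ?_
        rw [Real.volume_Icc, Real.volume_Icc]
    _ = _ := by
        rw [← ENNReal.ofReal_add (by linarith) (by linarith)]
        congr 1
        rw [ht]
        ring

lemma productNoise_utility {b : ℝ} (hα : 0 < α)
    (hb : b ≤ Real.exp (2 * 2 ^ doublings (Real.log (Real.log d)) d)) :
    randomnessLaw {ω | ∃ j : Fin d, α ≤ |productNoise d α ω j|} ≤
      ENNReal.ofReal (d * Real.exp (1 - b)) := by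
  set i := doublings (Real.log (Real.log d)) d with hi
  have hr0 : 0 < Real.sqrt (2 ^ i) := by positivity
  have hS : MeasurableSet {u | 4 * Real.sqrt (2 ^ i) ≤ |quantile i u|} := by
    have := measurable_quantile i
    exact measurableSet_le measurable_const (by fun_prop)
  calc randomnessLaw {ω | ∃ j : Fin d, α ≤ |productNoise d α ω j|}
      ≤ randomnessLaw (⋃ j : Fin d, {ω | 4 * Real.sqrt (2 ^ i) ≤ |quantile i (ω.1 j)|}) := by
        refine measure_mono fun ω hω => ?_
        obtain ⟨j, hj⟩ := hω
        refine Set.mem_iUnion.2 ⟨j, ?_⟩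
        rw [productNoise, ← hi, abs_mul, abs_of_pos (by positivity), div_mul_eq_mul_div,
          le_div_iff₀ (by positivity)] at hj
        exact le_of_mul_le_mul_left hj hα
    _ ≤ ∑ j : Fin d, randomnessLaw {ω | 4 * Real.sqrt (2 ^ i) ≤ |quantile i (ω.1 j)|} :=
        measure_iUnion_fintype_le _ _
    _ ≤ ∑ _j : Fin d, ENNReal.ofReal (Real.exp (1 - b)) := by
        refine Finset.sum_le_sum fun j _ => ?_
        have hlaw : randomnessLaw.map (fun ω => (ω.1 j : ℝ)) =
            volume.restrict (Set.Ioo (0 : ℝ) 1) := by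
          have : IsProbabilityMeasure (volume.restrict (Set.Ioo (0 : ℝ) 1)) := ⟨by simp⟩
          rw [← (measurePreserving_eval (fun _ : Fin d => volume.restrict (Set.Ioo (0 : ℝ) 1))
            j).map_eq, ← map_uniforms (e := fun j : Fin d => (j : ℕ)) Fin.val_injective,
            Measure.map_map (by fun_prop) (by fun_prop)]
          rfl
        refine le_trans (le_of_eq ?_) (volume_quantile_le hb)
        rw [← hlaw, Measure.map_apply (by fun_prop) hS]
        rfl
    _ = _ := by
        rw [ENNReal.ofReal_mul (by positivity)]
        simp

end

section

/-! ### The mechanism -/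

/-- The projection of `ℝ^d` onto the cube. -/
def clipVec {d : ℕ} (x : Fin d → ℝ) : Cube d := fun j => ⟨clip (x j), clip_mem _⟩

lemma measurable_clipVec {d : ℕ} : Measurable (clipVec (d := d)) := by
  have := measurable_clip
  exact measurable_pi_lambda _ fun j => Measurable.subtype_mk (by fun_prop)

lemma measurable_toReal {d : ℕ} : Measurable (Cube.toReal (d := d)) :=
  measurable_pi_lambda _ fun j => measurable_subtype_coe.comp (measurable_pi_apply j)

lemma exists_implements {P : Program} {n d : ℕ} {ε δ α : ℝ}
    {f : Database n d → Randomness → Fin d → ℝ} (hf : ∀ D, Measurable (f D))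
    (hout : ∀ D ω, P.output ε δ α D ω = (clipVec (f D ω)).toReal) :
    ∃ M : Mechanism n d, P.Implements ε δ α M ∧ ∀ D (S : Set (Cube d)), MeasurableSet S →
      (M D : Measure (Cube d)) S = randomnessLaw {ω | clipVec (f D ω) ∈ S} := by
  have hm : ∀ D, Measurable fun ω => clipVec (f D ω) := fun D => measurable_clipVec.comp (hf D)
  refine ⟨fun D => ⟨randomnessLaw.map fun ω => clipVec (f D ω),
    Measure.isProbabilityMeasure_map (hm D).aemeasurable⟩, fun D => ?_, fun D S hS =>
    Measure.map_apply (hm D) hS⟩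
  have e : P.output ε δ α D = Cube.toReal ∘ fun ω => clipVec (f D ω) := funext (hout D)
  rw [e]
  exact ⟨measurable_toReal.comp (hm D), (Measure.map_map measurable_toReal (hm D)).symm⟩

variable {n d : ℕ}

lemma abs_marginals_le (hn : 1 ≤ n) (D : Database n d) (j : Fin d) : |marginals D j| ≤ 1 := by
  have hn' : (0 : ℝ) < n := by exact_mod_cast hn
  rw [marginals, abs_mul, abs_of_pos (by positivity), one_div, inv_mul_le_iff₀ hn', mul_one]
  calc _ ≤ ∑ i : Fin n, |(((D i j : ℤˣ) : ℤ) : ℝ)| := Finset.abs_sum_le_sum_abs _ _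
    _ = ∑ i : Fin n, 1 := by
        refine Finset.sum_congr rfl fun i _ => ?_
        rcases Int.units_eq_one_or (D i j) with h | h <;> simp [h]
    _ = n := by simp

lemma abs_marginals_sub_le {D D' : Database n d} (h : Adjacent D D') (j : Fin d) :
    |marginals D j - marginals D' j| ≤ 2 / n := by
  obtain ⟨i, hi⟩ := h
  have e : marginals D j - marginals D' j =
      1 / (n : ℝ) * ((((D i j : ℤˣ) : ℤ) : ℝ) - (((D' i j : ℤˣ) : ℤ) : ℝ)) := by
    rw [marginals, marginals, ← mul_sub, ← Finset.sum_sub_distrib,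
      Finset.sum_eq_single i (fun k _ hk => by rw [hi k hk, sub_self]) (by simp)]
  rw [e, abs_mul, abs_of_nonneg (by positivity), one_div, div_eq_inv_mul]
  gcongr
  rcases Int.units_eq_one_or (D i j) with h | h <;>
    rcases Int.units_eq_one_or (D' i j) with h' | h' <;> norm_num [h, h']

/-- Clipping is post-processing: an event for the output pulls back to an event for the unclipped
vector. -/
lemma isDP_of_noise {ε δ : ℝ} (hδ : 0 ≤ δ) {M : Mechanism n d} {N : Randomness → Fin d → ℝ}
    (hM : ∀ D (S : Set (Cube d)), MeasurableSet S →
      (M D : Measure (Cube d)) S = randomnessLaw {ω | clipVec (marginals D + N ω) ∈ S})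
    (hN : ∀ a a' : Fin d → ℝ, (∀ j, |a j - a' j| ≤ 2 / n) → ∀ A, MeasurableSet A →
      randomnessLaw {ω | a + N ω ∈ A} ≤
        ENNReal.ofReal (Real.exp ε) * randomnessLaw {ω | a' + N ω ∈ A} + ENNReal.ofReal δ) :
    IsDP ε δ M := by
  intro D D' hD S hS
  have h := hN _ _ (abs_marginals_sub_le hD) (clipVec ⁻¹' S) (measurable_clipVec hS)
  simp only [Set.mem_preimage] at h
  rw [← hM D S hS, ← hM D' S hS] at h
  have h' := ENNReal.toReal_mono (by finiteness) h
  rw [ENNReal.toReal_add (by finiteness) (by finiteness), ENNReal.toReal_mul,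
    ENNReal.toReal_ofReal (Real.exp_pos _).le, ENNReal.toReal_ofReal hδ] at h'
  exact h'

lemma utility_of_noise {α β : ℝ} (hn : 1 ≤ n) (hα : 0 < α) (hβ : 0 ≤ β) {M : Mechanism n d}
    {N : Randomness → Fin d → ℝ}
    (hM : ∀ D (S : Set (Cube d)), MeasurableSet S →
      (M D : Measure (Cube d)) S = randomnessLaw {ω | clipVec (marginals D + N ω) ∈ S})
    (hN : randomnessLaw {ω | ∃ j, α ≤ |N ω j|} ≤ ENNReal.ofReal β) (D : Database n d) :
    (M D : Measure (Cube d)).real {y | α ≤ ‖y.toReal - marginals D‖} ≤ β := by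
  have hS : MeasurableSet {y : Cube d | α ≤ ‖y.toReal - marginals D‖} :=
    measurableSet_le measurable_const ((measurable_toReal.sub_const _).norm)
  rw [measureReal_def, hM D _ hS]
  refine ENNReal.toReal_le_of_le_ofReal hβ (le_trans (measure_mono fun ω hω => ?_) hN)
  by_contra hcon
  simp only [Set.mem_ofPred_eq, not_exists, not_le] at hcon hω
  refine hω.not_gt ((pi_norm_lt_iff hα).2 fun j => lt_of_le_of_lt ?_ (hcon j))
  have := abs_le.1 (abs_marginals_le hn D j)
  exact abs_clip_add_sub_le this.1 this.2

/-! ### The choice of the parameters -/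

/-- Loop invariant: either every iteration so far has doubled or the threshold is reached, and the
last doubling started below `L`. -/
lemma doublings_bounds (L : ℝ) (k : ℕ) :
    (doublings L k = k ∨ L ≤ 2 ^ doublings L k) ∧
      (doublings L k = 0 ∨ (2 : ℝ) ^ doublings L k < 2 * L) := by
  induction k with
  | zero => exact ⟨Or.inl rfl, Or.inl rfl⟩
  | succ k ih =>
    rw [doublings]
    split_ifs with h
    · exact ⟨Or.inr h, ih.2⟩
    · exact ⟨Or.inl (by rw [ih.1.resolve_right h]), Or.inr (by rw [pow_succ]; linarith)⟩

lemma le_two_pow_doublings (d : ℕ) :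
    Real.log (Real.log d) ≤ 2 ^ doublings (Real.log (Real.log d)) d := by
  rcases (doublings_bounds _ d).1 with h | h
  · rw [h]
    calc Real.log (Real.log d) ≤ Real.log d := Real.log_le_self (Real.log_natCast_nonneg d)
      _ ≤ d := Real.log_le_self (Nat.cast_nonneg d)
      _ ≤ 2 ^ d := by exact_mod_cast Nat.lt_two_pow_self.le
  · exact h

lemma one_le_doublings (hL : 1 < Real.log (Real.log d)) :
    1 ≤ doublings (Real.log (Real.log d)) d := by
  rw [Nat.one_le_iff_ne_zero]
  intro h
  have := le_two_pow_doublings d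
  rw [h, pow_zero] at this
  linarith

lemma two_pow_doublings_lt (hL : 1 < Real.log (Real.log d)) :
    (2 : ℝ) ^ doublings (Real.log (Real.log d)) d < 2 * Real.log (Real.log d) :=
  (doublings_bounds _ d).2.resolve_left (Nat.one_le_iff_ne_zero.1 (one_le_doublings hL))

/-- The parameter choice for the product noise: `q` is its exponent, `2 * T / e` the order of the
exponential moment, and `8 * √q / m` the shift of the noise in multiples of its scale. -/
lemma moment_bounds {d L T q e m B : ℝ} (hd : 0 < d) (hL : 1 < L) (hT : 0 < T) (he : 0 < e)
    (hB : 1 ≤ B) {T' : ℝ} (hT' : T' ≤ B * T) (hT'0 : 0 < T')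
    (hq0 : 0 < q) (hq : q < 2 * L) (hbranch : T * L < d)
    (hm : 100000 * B * Real.sqrt (d * T * L) ≤ e * m) (hm0 : 0 < m) :
    2 * T' / e * (8 * Real.sqrt q / m) * Real.sqrt q ≤ 1 / 240 ∧
      d * (5529600 * (2 * T' / e * (8 * Real.sqrt q / m)) ^ 2) ≤ T' := by
  have hsq := Real.sq_sqrt hq0.le
  have hR := Real.sq_sqrt (by positivity : 0 ≤ d * T * L)
  have hR0 := Real.sqrt_nonneg (d * T * L)
  set R := Real.sqrt (d * T * L)
  -- The only use of the case assumption: it makes the order of the moment admissible.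
  have hTL : T * L ≤ R := by
    refine Real.le_sqrt_of_sq_le ?_
    have : 0 < T * L := by positivity
    nlinarith
  have hem : 0 < e * m := by positivity
  constructor
  · have e1 : 2 * T' / e * (8 * Real.sqrt q / m) * Real.sqrt q = 16 * T' * q / (e * m) := by
      field_simp
      rw [hsq]; ring
    rw [e1, div_le_div_iff₀ hem (by norm_num)]
    have h1 : T' * q ≤ B * T * (2 * L) := by gcongr
    have h2 : B * (T * L) ≤ B * R := by gcongr
    nlinarith
  · have e1 : d * (5529600 * (2 * T' / e * (8 * Real.sqrt q / m)) ^ 2) =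
        d * (5529600 * 256 * T' ^ 2 * q) / (e * m) ^ 2 := by
      field_simp
      rw [hsq]; ring
    rw [e1, div_le_iff₀ (by positivity)]
    have h1 : (100000 * B * R) ^ 2 ≤ (e * m) ^ 2 := by gcongr
    have h2 : T' * q ≤ B * T * (2 * L) := by gcongr
    have h3 : d * (T' * q) ≤ d * (B * T * (2 * L)) := by gcongr
    have h4 : B * (d * T * L) ≤ B ^ 2 * (d * T * L) := by
      gcongr
      nlinarith
    -- With `T' * q ≤ 2 * B * T * L` this amounts to `2 * 5529600 * 256 ≤ 100000 ^ 2`.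
    have h5 : d * (5529600 * 256 * (T' * q)) ≤ (e * m) ^ 2 := by
      have : (100000 * B * R) ^ 2 = 10000000000 * (B ^ 2 * (d * T * L)) := by
        rw [← hR]; ring
      have h6 : 0 ≤ B ^ 2 * (d * T * L) := by positivity
      nlinarith
    calc d * (5529600 * 256 * T' ^ 2 * q) = T' * (d * (5529600 * 256 * (T' * q))) := by ring
      _ ≤ T' * (e * m) ^ 2 := by gcongr

end

section

variable {n d : ℕ} {ε δ α B F : ℝ}

lemma noise_privacy (hε : 0 < ε) (hδ : 0 < δ) (hδ1 : δ < 1) (hα : 0 < α) (hn : 1 ≤ n)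
    (hL : 1 < Real.log (Real.log d)) (hB : 1 ≤ B) (hF : 1 ≤ F)
    (hεF : ε ≤ F * min ε 1) (hδB : Real.log (1 / min δ (1 / 2)) ≤ B * Real.log (1 / δ))
    (hC : 100000 * B * F * (Real.sqrt (d * Real.log (1 / δ) * Real.log (Real.log d)) / (ε * α)) ≤ n)
    (a a' : Fin d → ℝ) (ha : ∀ j, |a j - a' j| ≤ 2 / n) {A : Set (Fin d → ℝ)}
    (hA : MeasurableSet A) :
    randomnessLaw {ω | a + (fun j : Fin d => noise d δ α ω j) ∈ A} ≤
      ENNReal.ofReal (Real.exp ε) *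
        randomnessLaw {ω | a' + (fun j : Fin d => noise d δ α ω j) ∈ A} +
      ENNReal.ofReal δ := by
  have hd : 0 < d := Nat.pos_of_ne_zero fun h => by
    rw [h] at hL; norm_num at hL
  have hd' : (0 : ℝ) < d := by exact_mod_cast hd
  have hn' : (0 : ℝ) < n := by exact_mod_cast hn
  have hT : 0 < Real.log (1 / δ) := Real.log_pos (by rw [one_lt_div hδ]; exact hδ1)
  rw [← mul_div_assoc, div_le_iff₀ (by positivity)] at hC
  set L := Real.log (Real.log d) with hLdef
  set T := Real.log (1 / δ) with hTdef
  by_cases hbranch : (d : ℝ) ≤ T * L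
  · simp only [noise, ← hLdef, ← hTdef, if_pos hbranch]
    -- The scale mixture needs no additive slack, so `δ` is dropped.
    refine (cubeNoise_privacy hd hα ha hA).trans (le_add_right ?_)
    gcongr
    have hd2 : (d : ℝ) ≤ Real.sqrt (d * T * L) := by
      refine Real.le_sqrt_of_sq_le ?_
      nlinarith
    have hR : 16 * (d : ℝ) ≤ n * (ε * α) := by
      have h1 : 1 ≤ B * F := one_le_mul_of_one_le_of_one_le hB hF
      have h2 := mul_le_mul h1 hd2 hd'.le (by linarith)
      nlinarith
    calc (1 + 2 / n / (α / 4)) ^ (2 * d) ≤ Real.exp (2 / n / (α / 4)) ^ (2 * d) := by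
          gcongr
          rw [add_comm]
          exact Real.add_one_le_exp _
      _ = Real.exp (16 * d / (n * α)) := by
          rw [← Real.exp_nat_mul]
          congr 1
          push_cast
          field_simp
          norm_num
      _ ≤ Real.exp ε := by
          gcongr
          rw [div_le_iff₀ (by positivity)]
          linarith
  · simp only [noise, ← hLdef, ← hTdef, if_neg hbranch]
    have hδ'0 : 0 < min δ (1 / 2) := lt_min hδ (by norm_num)
    set e := min ε 1
    have he0 : 0 < e := lt_min hε one_pos
    have he1 : e ≤ 1 := min_le_right _ _
    set T' := Real.log (1 / min δ (1 / 2)) with hT'def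
    -- Capping `δ` at `1 / 2` and `ε` at `1` guarantees that the moment order `2 * T' / e` is at
    -- least `1`.
    have hT'2 : 1 / 2 ≤ T' := by
      have : Real.log 2 ≤ T' := Real.log_le_log two_pos (by
        rw [le_div_iff₀ hδ'0]
        linarith [min_le_right δ (1 / 2)])
      linarith [Real.log_two_gt_d9]
    set i := doublings L d with hi
    have hr0 : 0 < Real.sqrt ((2 : ℝ) ^ i) := by positivity
    have hm : 100000 * B * Real.sqrt (d * T * L) ≤ e * (n * α) := by
      have h1 : n * (ε * α) ≤ n * (F * e * α) := by gcongr
      refine le_of_mul_le_mul_left (a := F) ?_ (by linarith)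
      linarith
    obtain ⟨h1, h2⟩ := moment_bounds hd' hL hT he0 hB hδB (by linarith)
      (by positivity) (two_pow_doublings_lt hL) (not_le.1 hbranch) hm (by positivity)
    have hl : 1 ≤ 2 * T' / e := by
      rw [le_div_iff₀ he0]
      linarith
    -- `s` is the sensitivity `2 / n` divided by the scale `α / (4 * √(2 ^ i))`. The order `l` makes
    -- `l * e = 2 * T'`: one `T'` pays for the moment, the other leaves `exp (-T') ≤ δ`.
    refine (productNoise_privacy (s := 8 * Real.sqrt (2 ^ i) / (n * α)) (l := 2 * T' / e) (ε := e)
      hα (one_le_doublings hL) hl h1 (fun j => (ha j).trans (le_of_eq ?_)) hA).trans ?_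
    · rw [← hLdef, ← hi]
      field_simp
      norm_num
    · gcongr
      · exact min_le_left _ _
      · calc Real.exp (d * (5529600 * (2 * T' / e * (8 * Real.sqrt (2 ^ i) / (n * α))) ^ 2) -
              2 * T' / e * e) ≤ Real.exp (-T') := by
              gcongr
              rw [div_mul_cancel₀ _ he0.ne']
              linarith
          _ = min δ (1 / 2) := by
              rw [hT'def, one_div, Real.log_inv, neg_neg, Real.exp_log hδ'0]
          _ ≤ δ := min_le_left _ _

/-! ### Accuracy of the combined noise -/

lemma sq_log_le {x : ℝ} (hx : 0 < x) (h1 : 0 ≤ Real.log x) : Real.log x ^ 2 ≤ x := by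
  have hs : 0 < Real.sqrt x := Real.sqrt_pos.2 hx
  have h2 : Real.log x ≤ Real.sqrt x := by
    have e : Real.log x = 2 * (Real.log (Real.sqrt x / 2) + Real.log 2) := by
      rw [Real.log_div hs.ne' two_ne_zero, Real.log_sqrt hx.le]; ring
    have := Real.log_le_sub_one_of_pos (by positivity : 0 < Real.sqrt x / 2)
    linarith [Real.log_two_lt_d9]
  calc Real.log x ^ 2 ≤ Real.sqrt x ^ 2 := by gcongr
    _ = x := Real.sq_sqrt hx.le

lemma one_div_rpow_log_sub (hd : 0 < d) : 1 / (d : ℝ) ^ (Real.log d - 3) =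
    Real.exp (-Real.log d ^ 2 + 3 * Real.log d) := by
  rw [Real.rpow_def_of_pos (by exact_mod_cast hd), one_div, ← Real.exp_neg]
  ring_nf

lemma noise_utility (hα : 0 < α) (hL : 1 < Real.log (Real.log d)) :
    randomnessLaw {ω | ∃ j : Fin d, α ≤ |noise d δ α ω j|} ≤
      ENNReal.ofReal (1 / (d : ℝ) ^ (Real.log d - 3)) := by
  have hd : 0 < d := Nat.pos_of_ne_zero fun h => by
    rw [h] at hL; norm_num at hL
  have hd' : (0 : ℝ) < d := by exact_mod_cast hd
  have hlog1 : 1 < Real.log d := (Real.log_pos_iff (Real.log_natCast_nonneg d)).1 (by linarith)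
  rw [one_div_rpow_log_sub hd]
  by_cases hbranch : (d : ℝ) ≤ Real.log (1 / δ) * Real.log (Real.log d)
  · simp only [noise, if_pos hbranch]
    refine (cubeNoise_utility hα).trans (ENNReal.ofReal_le_ofReal (Real.exp_le_exp.2 ?_))
    have := sq_log_le hd' (by linarith)
    linarith
  · simp only [noise, if_neg hbranch]
    -- `(log d) ^ 2 = exp (2 * log log d)`, which is why the exponent `q` only has to reach `log log
    -- d`.
    refine (productNoise_utility (b := Real.log d ^ 2) hα ?_).trans
      (ENNReal.ofReal_le_ofReal ?_)
    · calc Real.log d ^ 2 = Real.exp (2 * Real.log (Real.log d)) := by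
            rw [mul_comm, Real.exp_mul, Real.exp_log (by linarith)]
            norm_cast
        _ ≤ _ := by
            gcongr
            exact le_two_pow_doublings d
    · calc (d : ℝ) * Real.exp (1 - Real.log d ^ 2)
          = Real.exp (Real.log d + (1 - Real.log d ^ 2)) := by
            rw [Real.exp_add, Real.exp_log hd']
        _ ≤ _ := Real.exp_le_exp.2 (by linarith)

lemma log_le_three (hL : Real.log (Real.log d) ≤ 1) : Real.log d ≤ 3 := by
  rcases (Real.log_natCast_nonneg d).eq_or_lt with h | h
  · rw [← h]; norm_num
  · have := (Real.log_le_iff_le_exp h).1 hL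
    linarith [Real.exp_one_lt_d9]

end

end OneWayMarginals

end

/-- Answering one-way marginals in the sup norm with approximate differential privacy. One program
`P`, with running time polynomial in `n` and `d`, serves all parameters; `w` is the `ω(1)` in the
exponent; the constant `C` of the sample bound depends only on the upper bounds `ε₀` for `ε` and
`δ₀ < 1` for `δ`. -/
theorem theorem1p3 :
    ∃ (P : Program) (K : ℕ) (w : ℕ → ℝ), Filter.Tendsto w Filter.atTop Filter.atTop ∧
      ∀ ε₀ δ₀ : ℝ, δ₀ < 1 → ∃ C : ℝ, 0 < C ∧
        ∀ ε δ α : ℝ, 0 < ε → ε ≤ ε₀ → 0 < δ → δ ≤ δ₀ → 0 < α →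
        ∀ d n : ℕ, 1 ≤ d → 1 ≤ n →
          C * (Real.sqrt (d * Real.log (1 / δ) * Real.log (Real.log d)) / (ε * α)) ≤ n →
          ∃ M : Mechanism n d,
            (P.Implements ε δ α M ∧
              ∀ (D : Database n d) (ω : Randomness), P.runtime ε δ α D ω ≤ K * (n + d) ^ K) ∧
            IsDP ε δ M ∧
            ∀ D : Database n d,
              (M D : MeasureTheory.Measure (Cube d)).real {y | α ≤ ‖y.toReal - marginals D‖} ≤
                1 / (d : ℝ) ^ w d := by
  refine ⟨marginalProgram, 540, fun d => Real.log d - 3,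
    Filter.tendsto_atTop_add_const_right _ (-3)
      (Real.tendsto_log_atTop.comp tendsto_natCast_atTop_atTop), fun ε₀ δ₀ hδ₀ => ?_⟩
  have hB : 1 ≤ max 1 (Real.log 2 / Real.log (1 / δ₀)) := le_max_left _ _
  have hF : 1 ≤ max 1 ε₀ := le_max_left _ _
  -- The two maxima pay for replacing `δ` by `min δ (1 / 2)` and `ε` by `min ε 1`.
  refine ⟨100000 * max 1 (Real.log 2 / Real.log (1 / δ₀)) * max 1 ε₀, by positivity, ?_⟩
  intro ε δ α hε hεε₀ hδ hδδ₀ hα d n hd hn hC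
  have hd1 : (1 : ℝ) ≤ d := by exact_mod_cast hd
  by_cases hL : Real.log (Real.log d) ≤ 1
  · obtain ⟨M, hM, hM'⟩ := exists_implements (P := marginalProgram) (ε := ε) (δ := δ) (α := α)
      (f := fun (_ : Database n d) _ => 0) (fun _ => measurable_const) fun D ω => by
        rw [output_marginalProgram, if_pos hL]
        ext j
        simp [Cube.toReal, clipVec, clip]
    refine ⟨M, ⟨hM, marginalProgram_runtime_le hd ε δ α⟩, ?_, fun D => ?_⟩
    · intro D D' _ S hS
      rw [MeasureTheory.measureReal_def, MeasureTheory.measureReal_def, hM' D S hS, hM' D' S hS]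
      have h1 := Real.one_le_exp hε.le
      have h2 : 0 ≤ (randomnessLaw {_ω | clipVec (0 : Fin d → ℝ) ∈ S}).toReal :=
        ENNReal.toReal_nonneg
      nlinarith
    -- Here `log d ≤ 3`, so the exponent is nonpositive and the claimed probability bound is at
    -- least one.
    · refine MeasureTheory.measureReal_le_one.trans ?_
      rw [one_le_div (by positivity)]
      exact Real.rpow_le_one_of_one_le_of_nonpos hd1 (by linarith [log_le_three hL])
  · obtain ⟨M, hM, hM'⟩ := exists_implements (P := marginalProgram) (ε := ε) (δ := δ) (α := α)
      (f := fun (D : Database n d) ω => marginals D + fun j : Fin d => noise d δ α ω j)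
      (fun D => (measurable_noise d δ α).const_add _) fun D ω => by
        rw [output_marginalProgram, if_neg hL]
        rfl
    rw [not_le] at hL
    refine ⟨M, ⟨hM, marginalProgram_runtime_le hd ε δ α⟩, isDP_of_noise hδ.le hM' ?_,
      utility_of_noise hn hα (by positivity) hM' (noise_utility hα hL)⟩
    intro a a' ha A hA
    refine noise_privacy hε hδ (hδδ₀.trans_lt hδ₀) hα hn hL hB hF ?_ ?_ hC a a' ha hA
    · rcases min_cases ε 1 with h | h
      · rw [h.1]
        exact le_mul_of_one_le_left hε.le hF
      · rw [h.1, mul_one]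
        exact hεε₀.trans (le_max_right _ _)
    · have hδ₀0 : 0 < δ₀ := hδ.trans_le hδδ₀
      have hT₀ : 0 < Real.log (1 / δ₀) := Real.log_pos (by rwa [one_lt_div hδ₀0])
      have hT : Real.log (1 / δ₀) ≤ Real.log (1 / δ) :=
        Real.log_le_log (by positivity) (one_div_le_one_div_of_le hδ hδδ₀)
      rcases min_cases δ (1 / 2) with h | h
      · rw [h.1]
        exact le_mul_of_one_le_left (hT₀.le.trans hT) hB
      · rw [h.1, one_div_one_div]
        calc Real.log 2 = Real.log 2 / Real.log (1 / δ₀) * Real.log (1 / δ₀) :=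
              (div_mul_cancel₀ _ hT₀.ne').symm
          _ ≤ _ := by
              gcongr
              exact le_max_right _ _
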